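/- Let $d\ge 3$ be an odd integer, let $X=\{1,\dots,d\}$, and let $T$ be the $d$-regular rooted tree with vertex set $X^*$. Let $\mathrm{Aut}(T)$ be the group of graph automorphisms of $T$ that fix the root, and for a subgroup $H\le\mathrm{Aut}(T)$ let $\mathrm{St}_H(\widehat k)$ be the subgroup of those elements of $H$ that fix every vertex in $X^k$. Give $\mathrm{Aut}(T)$ the metric $$\mathrm{dist}(g,h)=\inf\bigl\{[\mathrm{Aut}(T):\mathrm{St}_{\mathrm{Aut}(T)}(\widehat k)]^{-1} : k\ge 0,\ g^{-1}h\in \mathrm{St}_{\mathrm{Aut}(T)}(\widehat k)\bigr\},$$ which induces its profinite topology. Let $G_d\le\mathrm{Aut}(T)$ be the group generated by $a_1,\dots,a_d$, where, with indices modulo $d$, $a_i$ acts on the first level by the transposition $(i\ \,i{+}1)$, its section at $i$ is $a_i$, its section at $i+1$ is $a_{i+1}$, and its sections at the other letters are trivial. Let $\overline{G_d}$ be the closure of $G_d$ in $\mathrm{Aut}(T)$. Then the Hausdorff dimension of $\overline{G_d}$ with respect to this metric is $$\dim_H(\overline{G_d}) = 1-\frac{\log 2}{d\,\log (d!)},$$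 and likewise $$\liminf_{k\to\infty}\frac{\log\,[G_d:\mathrm{St}_{G_d}(\widehat k)]}{\log\,[\mathrm{Aut}(T):\mathrm{St}_{\mathrm{Aut}(T)}(\widehat k)]} = 1-\frac{\log 2}{d\,\log (d!)}.$$ In particular, $\dim_H(\overline{G_d})\to 1$ as $d\to\infty$ through the odd integers. -/

import Mathlib

namespace RootedTree

/-- The `d`-regular rooted tree: its vertices are the finite words over an alphabet with `d`
letters, its root is the empty word, and each word `u` is joined to its `d` children `u x`. -/
def tree (d : ℕ) : SimpleGraph (List (Fin d)) where
  Adj u v := (∃ x, v = u ++ [x]) ∨ (∃ x, u = v ++ [x])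
  symm := ⟨fun _ _ h => h.symm⟩
  loopless := ⟨fun u h => by
    rcases h with ⟨x, h⟩ | ⟨x, h⟩ <;> simpa using congrArg List.length h⟩

/-- `Aut(T)`: the group of all graph automorphisms of the tree that fix the root. -/
def AutT (d : ℕ) : Subgroup (tree d ≃g tree d) where
  carrier := {g | g [] = []}
  mul_mem' := by
    intro g h hg hh
    simp only [Set.mem_ofPred_eq] at *
    rw [RelIso.mul_apply, hh, hg]
  one_mem' := rfl
  inv_mem' := by
    intro g hg
    simp only [Set.mem_ofPred_eq] at *
    conv_lhs => rw [← hg]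
    exact RelIso.inv_apply_self g []

theorem AutT.ext {d : ℕ} {g h : AutT d} (H : ∀ u, g.1 u = h.1 u) : g = h :=
  Subtype.ext (RelIso.ext H)

theorem adj_iff {d : ℕ} {u v : List (Fin d)} :
    (tree d).Adj u v ↔ (∃ x, v = u ++ [x]) ∨ (∃ x, u = v ++ [x]) := Iff.rfl

theorem map_append_singleton {d : ℕ} (g : AutT d) (u : List (Fin d)) :
    ∀ x, ∃ y, g.1 (u ++ [x]) = g.1 u ++ [y] := by
  induction u using List.reverseRecOn with
  | nil =>
    intro x
    have hroot : g.1 [] = [] := g.2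
    have h : (tree d).Adj (g.1 []) (g.1 ([] ++ [x])) :=
      g.1.map_rel_iff.2 (Or.inl ⟨x, rfl⟩)
    rcases h with h | ⟨y, h⟩
    · exact h
    · rw [hroot] at h
      simpa using congrArg List.length h
  | append_singleton u z ih =>
    intro x
    obtain ⟨y, hy⟩ := ih z
    have h : (tree d).Adj (g.1 (u ++ [z])) (g.1 (u ++ [z] ++ [x])) :=
      g.1.map_rel_iff.2 (Or.inl ⟨x, rfl⟩)
    rcases h with h | ⟨y', h⟩
    · exact h
    · rw [hy] at h
      have h1 := (List.append_inj' h rfl).1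
      have h2 := g.1.injective h1
      simpa using congrArg List.length h2

theorem length_map {d : ℕ} (g : AutT d) (u : List (Fin d)) : (g.1 u).length = u.length := by
  induction u using List.reverseRecOn with
  | nil =>
    have hroot : g.1 [] = [] := g.2
    rw [hroot]
  | append_singleton u x ih =>
    obtain ⟨y, hy⟩ := map_append_singleton g u x
    rw [hy]
    simp [ih]

/-- The `k`-th level stabilizer in `Aut(T)`: the automorphisms that fix every word of
length `k`. -/
def levelStab (d k : ℕ) : Subgroup (AutT d) where
  carrier := {g | ∀ u : List (Fin d), u.length = k → g.1 u = u}
  mul_mem' := by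
    intro g h hg hh u hu
    change (g.1 * h.1) u = u
    rw [RelIso.mul_apply, hh u hu, hg u hu]
  one_mem' := fun _ _ => rfl
  inv_mem' := by
    intro g hg u hu
    change (g.1⁻¹) u = u
    conv_lhs => rw [← hg u hu]
    exact RelIso.inv_apply_self g.1 u

theorem mem_levelStab {d k : ℕ} {g : AutT d} :
    g ∈ levelStab d k ↔ ∀ u : List (Fin d), u.length = k → g.1 u = u := Iff.rfl

theorem inv_mul_mem_levelStab {d k : ℕ} {g h : AutT d} :
    g⁻¹ * h ∈ levelStab d k ↔ ∀ u : List (Fin d), u.length = k → g.1 u = h.1 u := by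
  rw [mem_levelStab]
  refine forall₂_congr fun u _ => ?_
  change (g.1⁻¹ * h.1) u = u ↔ _
  rw [RelIso.mul_apply]
  constructor
  · intro H
    rw [← H, RelIso.apply_inv_self, H]
  · intro H
    rw [← H, RelIso.inv_apply_self]

theorem levelStab_succ_le (d k : ℕ) : levelStab d (k + 1) ≤ levelStab d k := by
  intro g hg u hu
  cases d with
  | zero =>
    cases u with
    | nil => exact g.2
    | cons x _ => exact x.elim0
  | succ d =>
    obtain ⟨y, hy⟩ := map_append_singleton g u 0
    have h := hg (u ++ [0]) (by simp [hu])
    rw [hy] at h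
    exact (List.append_inj' h rfl).1

theorem levelStab_antitone (d : ℕ) : Antitone (levelStab d) :=
  antitone_nat_of_succ_le (levelStab_succ_le d)

theorem levelStab_zero (d : ℕ) : levelStab d 0 = ⊤ := by
  refine eq_top_iff.2 fun g _ u hu => ?_
  rw [List.length_eq_zero_iff.1 hu]
  exact g.2

instance levelStab_finiteIndex (d k : ℕ) : (levelStab d k).FiniteIndex := by
  have : Finite {u : List (Fin d) // u.length = k} :=
    inferInstanceAs (Finite (List.Vector (Fin d) k))
  refine @Subgroup.finiteIndex_of_finite_quotient _ _ _ ?_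
  let F : AutT d → ({u : List (Fin d) // u.length = k} → {u : List (Fin d) // u.length = k}) :=
    fun g u => ⟨g.1 u.1, by rw [length_map]; exact u.2⟩
  have hF : ∀ g h : AutT d, F g = F h ↔ g⁻¹ * h ∈ levelStab d k := by
    intro g h
    rw [inv_mul_mem_levelStab]
    constructor
    · intro H u hu
      exact congrArg Subtype.val (congrFun H ⟨u, hu⟩)
    · intro H
      funext u
      exact Subtype.ext (H u.1 u.2)
  refine Finite.of_injective
    (Quotient.lift (s := QuotientGroup.leftRel (levelStab d k)) F fun g h H =>
      (hF g h).2 (QuotientGroup.leftRel_apply.1 H)) ?_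
  rintro ⟨g⟩ ⟨h⟩ H
  exact Quotient.sound (QuotientGroup.leftRel_apply.2 ((hF g h).1 H))

/-- The reals `[Aut(T) : St(k)]⁻¹` over all `k` for which `g` and `h` agree on level `k`. -/
def radii {d : ℕ} (g h : AutT d) : Set ℝ :=
  {r | ∃ k : ℕ, g⁻¹ * h ∈ levelStab d k ∧ r = ((levelStab d k).index : ℝ)⁻¹}

open Classical in
/-- The distance on `Aut(T)` that belongs to its filtration by the level stabilizers:
`dist g h = inf {[Aut(T) : St(k)]⁻¹ : g⁻¹ h ∈ St(k)}`. The infimum is `0` by itself for `g = h`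
when `d ≥ 2`; the case distinction only matters for the trivial group `Aut(T)`, `d ≤ 1`. -/
noncomputable def distance {d : ℕ} (g h : AutT d) : ℝ := if g = h then 0 else sInf (radii g h)

theorem radii_comm {d : ℕ} (g h : AutT d) : radii g h = radii h g := by
  ext r
  refine exists_congr fun k => and_congr_left fun _ => ?_
  rw [inv_mul_mem_levelStab, inv_mul_mem_levelStab]
  exact forall₂_congr fun _ _ => eq_comm

theorem radii_nonempty {d : ℕ} (g h : AutT d) : (radii g h).Nonempty :=
  ⟨_, 0, by rw [levelStab_zero]; trivial, rfl⟩

theorem radii_nonneg {d : ℕ} {g h : AutT d} {r : ℝ} (hr : r ∈ radii g h) : 0 ≤ r := by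
  obtain ⟨k, -, rfl⟩ := hr
  positivity

theorem radii_bddBelow {d : ℕ} (g h : AutT d) : BddBelow (radii g h) :=
  ⟨0, fun _ hr => radii_nonneg hr⟩

theorem index_inv_pos (d k : ℕ) : 0 < ((levelStab d k).index : ℝ)⁻¹ :=
  inv_pos.2 (Nat.cast_pos.2 (Nat.pos_of_ne_zero Subgroup.FiniteIndex.index_ne_zero))

theorem index_inv_antitone (d : ℕ) : Antitone fun k => ((levelStab d k).index : ℝ)⁻¹ := by
  intro k l hkl
  have h0 : (levelStab d l).index ≠ 0 := Subgroup.FiniteIndex.index_ne_zero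
  have h := Nat.le_of_dvd (Nat.pos_of_ne_zero h0)
    (Subgroup.index_dvd_of_le (levelStab_antitone d hkl))
  exact inv_anti₀ (inv_pos.1 (index_inv_pos d k)) (Nat.cast_le.2 h)

theorem sInf_radii_pos {d : ℕ} {g h : AutT d} (hgh : g ≠ h) : 0 < sInf (radii g h) := by
  obtain ⟨u, hu⟩ : ∃ u, g.1 u ≠ h.1 u := by
    by_contra! H
    exact hgh (AutT.ext H)
  refine lt_of_lt_of_le (index_inv_pos d u.length) (le_csInf (radii_nonempty g h) ?_)
  rintro r ⟨k, hk, rfl⟩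
  refine index_inv_antitone d (le_of_not_gt fun hlt => hu ?_)
  exact inv_mul_mem_levelStab.1 (levelStab_antitone d hlt.le hk) u rfl

theorem distance_nonneg {d : ℕ} (g h : AutT d) : 0 ≤ distance g h := by
  unfold distance
  split_ifs with H
  · exact le_rfl
  · exact (sInf_radii_pos H).le

theorem distance_triangle {d : ℕ} (f g h : AutT d) :
    distance f h ≤ distance f g + distance g h := by
  by_cases hfg : f = g
  · subst hfg
    simp [distance]
  by_cases hgh : g = h
  · subst hgh
    simp [distance]
  by_cases hfh : f = h
  · have h1 := distance_nonneg f g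
    have h2 := distance_nonneg g h
    have h3 : distance f h = 0 := if_pos hfh
    linarith
  simp only [distance, if_neg hfg, if_neg hgh, if_neg hfh]
  have key : ∀ a ∈ radii f g, ∀ b ∈ radii g h, sInf (radii f h) ≤ a + b := by
    intro a ha b hb
    have ha0 := radii_nonneg ha
    have hb0 := radii_nonneg hb
    obtain ⟨k, hk, rfl⟩ := ha
    obtain ⟨l, hl, rfl⟩ := hb
    rcases le_total k l with hkl | hkl
    · have hm : f⁻¹ * h ∈ levelStab d k := by
        have := mul_mem hk (levelStab_antitone d hkl hl)
        rwa [mul_assoc, mul_inv_cancel_left] at this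
      linarith [csInf_le (radii_bddBelow f h) ⟨k, hm, rfl⟩]
    · have hm : f⁻¹ * h ∈ levelStab d l := by
        have := mul_mem (levelStab_antitone d hkl hk) hl
        rwa [mul_assoc, mul_inv_cancel_left] at this
      linarith [csInf_le (radii_bddBelow f h) ⟨l, hm, rfl⟩]
  have h1 : sInf (radii f h) - sInf (radii g h) ≤ sInf (radii f g) := by
    refine le_csInf (radii_nonempty f g) fun a ha => ?_
    have h2 : sInf (radii f h) - a ≤ sInf (radii g h) :=
      le_csInf (radii_nonempty g h) fun b hb => by linarith [key a ha b hb]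
    linarith
  linarith

/-- `Aut(T)` as a metric space; for `d ≥ 2` the level stabilizers are a neighbourhood basis of
the identity, so that the topology is the profinite one. -/
noncomputable instance instMetricSpaceAutT (d : ℕ) : MetricSpace (AutT d) where
  dist := distance
  dist_self g := if_pos rfl
  dist_comm g h := by
    by_cases H : g = h
    · rw [H]
    · simp only [distance, if_neg H, if_neg (Ne.symm H), radii_comm g h]
  dist_triangle := distance_triangle
  eq_of_dist_eq_zero := by
    intro g h H
    by_contra hne
    have H' : distance g h = 0 := H
    simp only [distance, if_neg hne] at H'
    exact (sInf_radii_pos hne).ne' H'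

/-- The transposition `(i  i+1)` of the letters, with `i + 1` taken modulo `d`. -/
def letterSwap {d : ℕ} (i : Fin d) : Equiv.Perm (Fin d) := Equiv.swap i (finRotate d i)

theorem letterSwap_invol {d : ℕ} (i x : Fin d) : letterSwap i (letterSwap i x) = x :=
  Equiv.swap_apply_self _ _ _

/-- The action of the generator `a_i` on words, by its wreath recursion: the root permutation
is `(i  i+1)`, the section at `i` is `a_i`, the section at `i + 1` is `a_{i+1}`, and the sections
at the other letters are trivial (indices modulo `d`). -/
def genMap {d : ℕ} : Fin d → List (Fin d) → List (Fin d)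
  | _, [] => []
  | i, x :: w => letterSwap i x :: (if x = i ∨ x = finRotate d i then genMap x w else w)

/-- The inverse of `genMap i`. -/
def genInv {d : ℕ} : Fin d → List (Fin d) → List (Fin d)
  | _, [] => []
  | i, y :: w => letterSwap i y ::
      (if letterSwap i y = i ∨ letterSwap i y = finRotate d i then genInv (letterSwap i y) w else w)

theorem genInv_genMap {d : ℕ} (w : List (Fin d)) : ∀ i, genInv i (genMap i w) = w := by
  induction w with
  | nil => intro i; rfl
  | cons x w ih =>
    intro i
    simp only [genMap, genInv, letterSwap_invol]
    split_ifs
    · rw [ih]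
    · rfl

theorem genMap_genInv {d : ℕ} (w : List (Fin d)) : ∀ i, genMap i (genInv i w) = w := by
  induction w with
  | nil => intro i; rfl
  | cons x w ih =>
    intro i
    simp only [genMap, genInv, letterSwap_invol]
    split_ifs
    · rw [ih]
    · rfl

theorem genMap_append {d : ℕ} (w : List (Fin d)) (x : Fin d) :
    ∀ i, ∃ y, genMap i (w ++ [x]) = genMap i w ++ [y] := by
  induction w with
  | nil => intro i; exact ⟨letterSwap i x, by simp [genMap]⟩
  | cons z w ih =>
    intro i
    by_cases h : z = i ∨ z = finRotate d i
    · obtain ⟨y, hy⟩ := ih z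
      exact ⟨y, by simp only [List.cons_append, genMap, if_pos h, hy]⟩
    · exact ⟨x, by simp only [List.cons_append, genMap, if_neg h]⟩

theorem genInv_append {d : ℕ} (w : List (Fin d)) (x : Fin d) :
    ∀ i, ∃ y, genInv i (w ++ [x]) = genInv i w ++ [y] := by
  induction w with
  | nil => intro i; exact ⟨letterSwap i x, by simp [genInv]⟩
  | cons z w ih =>
    intro i
    by_cases h : letterSwap i z = i ∨ letterSwap i z = finRotate d i
    · obtain ⟨y, hy⟩ := ih (letterSwap i z)
      exact ⟨y, by simp only [List.cons_append, genInv, if_pos h, hy]⟩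
    · exact ⟨x, by simp only [List.cons_append, genInv, if_neg h]⟩

/-- The generator `a_i` as an element of `Aut(T)`. -/
def gen {d : ℕ} (i : Fin d) : AutT d :=
  ⟨{ toFun := genMap i
     invFun := genInv i
     left_inv := fun w => genInv_genMap w i
     right_inv := fun w => genMap_genInv w i
     map_rel_iff' := by
      have fwd : ∀ u v : List (Fin d), (tree d).Adj u v →
          (tree d).Adj (genMap i u) (genMap i v) := by
        rintro u v (⟨x, rfl⟩ | ⟨x, rfl⟩)
        · exact Or.inl (genMap_append u x i)
        · exact Or.inr (genMap_append v x i)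
      have bwd : ∀ u v : List (Fin d), (tree d).Adj u v →
          (tree d).Adj (genInv i u) (genInv i v) := by
        rintro u v (⟨x, rfl⟩ | ⟨x, rfl⟩)
        · exact Or.inl (genInv_append u x i)
        · exact Or.inr (genInv_append v x i)
      intro u v
      refine ⟨fun h => ?_, fwd u v⟩
      have h' := bwd _ _ h
      simpa only [Equiv.coe_fn_mk, genInv_genMap] using h' }, rfl⟩

/-- The group `G_d`, generated by `a_1, …, a_d`. -/
def G (d : ℕ) : Subgroup (AutT d) := Subgroup.closure (Set.range gen)

/-- The lower density `liminf_k log [H : St_H(k)] / log [Aut(T) : St(k)]`, where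
`St_H(k) = H ∩ St(k)`. -/
noncomputable def levelDimension {d : ℕ} (H : Subgroup (AutT d)) : ℝ :=
  Filter.liminf (fun k : ℕ =>
    Real.log ((levelStab d k).relIndex H : ℝ) / Real.log ((levelStab d k).index : ℝ)) Filter.atTop

end RootedTree

namespace RootedTree

/-! An element fixing the first level is the tuple of its sections. For `G d` with `d ≥ 3` odd, the
only constraint on such tuples of elements of `G d`, seen at any finite depth, is a sign condition:
a generator has exactly two nontrivial sections, both odd, so the signs of the sections of any
element of `G d` multiply to 1 (`prod_sgn_sec`). Write n_k and r_k for the indices of the k-th level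
stabilizer in `AutT d` and in `G d`. Then n_{k+1} = n_k^d · d!, whereas 2 r_{k+2} = r_{k+1}^d · d!
(`relIndex_levelStab_succ_succ`). Since r_1 = n_1 = d!, this gives log r_k = D log n_k + (log 2)/d
for k ≥ 1, with D the claimed dimension.

That there is no further constraint rests on branching. Oddness of d makes `G d` self-replicating
(`carries_of_mem`), and every even element occurs as a section of an element supported on two
letters (`mem_pairSections_of_sgn`). Commutators of two such elements whose supports share one
letter live on that letter alone; refining this yields that a copy of the commutator subgroup at any
single letter lies in `G d` (`commutator_le_rist`). Commutators also realise all sign patterns with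
product 1 (`mem_signPatterns`), and modulo each level stabilizer every even element is a product of
commutators (`evenInCommutator`). Together these realise every admissible tuple to any finite depth
(`EvenInCommutator.exists_sec_eq`).

For the Hausdorff dimension, a coset of the k-th level stabilizer has diameter at most 1/n_k.
Covering the closure by r_k cosets gives the upper bound; Haar measure on the compact closure and
the mass distribution principle give the lower bound. -/

variable {d : ℕ}

/-! ### Sections and the wreath decomposition -/

theorem apply_mul (g h : AutT d) (w : List (Fin d)) : (g * h).1 w = g.1 (h.1 w) := rfl

theorem inv_apply_self (g : AutT d) (w : List (Fin d)) : (g⁻¹).1 (g.1 w) = w :=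
  RelIso.inv_apply_self g.1 w

theorem apply_inv_self (g : AutT d) (w : List (Fin d)) : g.1 ((g⁻¹).1 w) = w :=
  RelIso.apply_inv_self g.1 w

/-- The automorphism of the tree given by a permutation of the words that, along with its inverse,
respects extension of words. -/
def ofEquiv (e : Equiv.Perm (List (Fin d))) (h₀ : e [] = [])
    (h₁ : ∀ u x, ∃ y, e (u ++ [x]) = e u ++ [y])
    (h₂ : ∀ u x, ∃ y, e.symm (u ++ [x]) = e.symm u ++ [y]) : AutT d :=
  ⟨{ toEquiv := e
     map_rel_iff' := by
      have fwd : ∀ u v : List (Fin d), (tree d).Adj u v → (tree d).Adj (e u) (e v) := by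
        rintro u v (⟨x, rfl⟩ | ⟨x, rfl⟩)
        · exact Or.inl (h₁ u x)
        · exact Or.inr (h₁ v x)
      have bwd : ∀ u v : List (Fin d),
          (tree d).Adj u v → (tree d).Adj (e.symm u) (e.symm v) := by
        rintro u v (⟨x, rfl⟩ | ⟨x, rfl⟩)
        · exact Or.inl (h₂ u x)
        · exact Or.inr (h₂ v x)
      intro u v
      exact ⟨fun h => by simpa using bwd _ _ h, fwd u v⟩ }, h₀⟩

/-- The action of an automorphism on the first level. -/
def rootFun (g : AutT d) (x : Fin d) : Fin d := (g.1 [x]).headD x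

/-- The action of the section of an automorphism at a letter. -/
def secFun (g : AutT d) (x : Fin d) (w : List (Fin d)) : List (Fin d) := (g.1 (x :: w)).tail

/-- Extension of words is respected, so the first letter of the image depends on `x` alone, and the
default values of `headD` and `tail` never occur. -/
theorem apply_cons' (g : AutT d) (x : Fin d) (w : List (Fin d)) :
    g.1 (x :: w) = rootFun g x :: secFun g x w := by
  induction w using List.reverseRecOn with
  | nil =>
    obtain ⟨y, hy⟩ := map_append_singleton g [] x
    have h0 : g.1 [] = [] := g.2
    rw [h0] at hy
    simp only [List.nil_append] at hy
    simp [rootFun, secFun, hy]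
  | append_singleton w z ih =>
    obtain ⟨y, hy⟩ := map_append_singleton g (x :: w) z
    rw [ih] at hy
    have : g.1 (x :: (w ++ [z])) = rootFun g x :: (secFun g x w ++ [y]) := hy
    rw [secFun, this, List.tail_cons]

theorem secFun_append (g : AutT d) (x : Fin d) (u : List (Fin d)) (z : Fin d) :
    ∃ y, secFun g x (u ++ [z]) = secFun g x u ++ [y] := by
  obtain ⟨y, hy⟩ := map_append_singleton g (x :: u) z
  refine ⟨y, ?_⟩
  have h := apply_cons' g x (u ++ [z])
  rw [← List.cons_append, hy, apply_cons'] at h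
  simpa using h.symm

theorem rootFun_mul (g h : AutT d) (x : Fin d) : rootFun (g * h) x = rootFun g (rootFun h x) := by
  have := apply_cons' (g * h) x []
  rw [apply_mul, apply_cons' h, apply_cons' g] at this
  exact (List.cons.inj this).1.symm

theorem secFun_mul (g h : AutT d) (x : Fin d) (w : List (Fin d)) :
    secFun (g * h) x w = secFun g (rootFun h x) (secFun h x w) := by
  have := apply_cons' (g * h) x w
  rw [apply_mul, apply_cons' h, apply_cons' g] at this
  exact (List.cons.inj this).2.symm

theorem rootFun_one (x : Fin d) : rootFun (1 : AutT d) x = x := rfl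

theorem secFun_one (x : Fin d) (w : List (Fin d)) : secFun (1 : AutT d) x w = w := rfl

/-- The permutation of the first level induced by an automorphism. -/
def root : AutT d →* Equiv.Perm (Fin d) where
  toFun g :=
    { toFun := rootFun g
      invFun := rootFun g⁻¹
      left_inv := fun x => by rw [← rootFun_mul, inv_mul_cancel, rootFun_one]
      right_inv := fun x => by rw [← rootFun_mul, mul_inv_cancel, rootFun_one] }
  map_one' := rfl
  map_mul' g h := Equiv.ext fun x => rootFun_mul g h x

/-- The section of an automorphism at a letter. -/
def sec (g : AutT d) (x : Fin d) : AutT d :=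
  ofEquiv
    { toFun := secFun g x
      invFun := secFun g⁻¹ (rootFun g x)
      left_inv := fun w => by rw [← secFun_mul, inv_mul_cancel, secFun_one]
      right_inv := fun w => by
        have h : rootFun g⁻¹ (rootFun g x) = x := by
          rw [← rootFun_mul, inv_mul_cancel, rootFun_one]
        conv_lhs => rw [← h]
        rw [h]
        have := secFun_mul g g⁻¹ (rootFun g x) w
        rw [h, mul_inv_cancel, secFun_one] at this
        exact this.symm }
    (by
      have := congrArg List.length (apply_cons' g x [])
      rw [length_map] at this
      simpa using this.symm)
    (fun u z => secFun_append g x u z)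
    (fun u z => secFun_append g⁻¹ _ u z)

theorem apply_cons (g : AutT d) (x : Fin d) (w : List (Fin d)) :
    g.1 (x :: w) = root g x :: (sec g x).1 w := apply_cons' g x w

theorem apply_nil (g : AutT d) : g.1 [] = [] := g.2

theorem ext_root_sec {g h : AutT d} (hr : root g = root h) (hs : ∀ x, sec g x = sec h x) :
    g = h := by
  refine AutT.ext fun u => ?_
  cases u with
  | nil => rw [apply_nil, apply_nil]
  | cons x w => rw [apply_cons, apply_cons, hr, hs]

theorem sec_mul (g h : AutT d) (x : Fin d) : sec (g * h) x = sec g (root h x) * sec h x :=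
  AutT.ext fun w => secFun_mul g h x w

@[simp] theorem sec_one (x : Fin d) : sec (1 : AutT d) x = 1 := rfl

theorem sec_inv (g : AutT d) (x : Fin d) : sec g⁻¹ x = (sec g (root g⁻¹ x))⁻¹ := by
  have h := sec_mul g g⁻¹ x
  rw [mul_inv_cancel, sec_one] at h
  exact eq_inv_of_mul_eq_one_right h.symm

/-- The automorphism that fixes the first level and has the given sections. -/
def diag : (Fin d → AutT d) →* AutT d where
  toFun f := ofEquiv
    { toFun := fun w => match w with
        | [] => []
        | x :: w => x :: (f x).1 w
      invFun := fun w => match w with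
        | [] => []
        | x :: w => x :: ((f x)⁻¹).1 w
      left_inv := by
        rintro (_ | ⟨x, w⟩)
        · rfl
        · simp only [inv_apply_self]
      right_inv := by
        rintro (_ | ⟨x, w⟩)
        · rfl
        · simp only [apply_inv_self] }
    rfl
    (by
      rintro (_ | ⟨x, w⟩) z
      · exact ⟨z, by simp [apply_nil]⟩
      · obtain ⟨y, hy⟩ := map_append_singleton (f x) w z
        exact ⟨y, by simp [hy]⟩)
    (by
      rintro (_ | ⟨x, w⟩) z
      · refine ⟨z, ?_⟩
        change z :: ((f z)⁻¹).1 [] = _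
        rw [apply_nil]
        rfl
      · obtain ⟨y, hy⟩ := map_append_singleton (f x)⁻¹ w z
        refine ⟨y, ?_⟩
        change x :: ((f x)⁻¹).1 (w ++ [z]) = _
        rw [hy]
        rfl)
  map_one' := AutT.ext fun w => by cases w <;> rfl
  map_mul' f g := AutT.ext fun w => by cases w <;> rfl

/-- The automorphism with trivial sections that permutes the first level as given. -/
def rooted (σ : Equiv.Perm (Fin d)) : AutT d :=
  ofEquiv
    { toFun := fun w => match w with
        | [] => []
        | x :: w => σ x :: w
      invFun := fun w => match w with
        | [] => []
        | x :: w => σ.symm x :: w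
      left_inv := by
        rintro (_ | ⟨x, w⟩)
        · rfl
        · simp
      right_inv := by
        rintro (_ | ⟨x, w⟩)
        · rfl
        · simp }
    rfl
    (by
      rintro (_ | ⟨x, w⟩) z
      · exact ⟨σ z, rfl⟩
      · exact ⟨z, rfl⟩)
    (by
      rintro (_ | ⟨x, w⟩) z
      · exact ⟨σ.symm z, rfl⟩
      · exact ⟨z, rfl⟩)

@[simp] theorem root_rooted (σ : Equiv.Perm (Fin d)) : root (rooted σ) = σ :=
  Equiv.ext fun _ => rfl

theorem root_surjective : Function.Surjective (root : AutT d →* _) :=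
  fun σ => ⟨rooted σ, root_rooted σ⟩

@[simp] theorem root_diag (f : Fin d → AutT d) : root (diag f) = 1 :=
  Equiv.ext fun _ => rfl

@[simp] theorem sec_diag (f : Fin d → AutT d) (x : Fin d) : sec (diag f) x = f x :=
  AutT.ext fun _ => rfl

theorem diag_sec {g : AutT d} (h : root g = 1) : diag (sec g) = g :=
  ext_root_sec (by rw [root_diag, h]) fun x => sec_diag _ x

theorem conj_diag (c : AutT d) (f : Fin d → AutT d) :
    c * diag f * c⁻¹ =
      diag fun x => sec c (root c⁻¹ x) * f (root c⁻¹ x) * (sec c (root c⁻¹ x))⁻¹ := by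
  refine ext_root_sec (by simp) fun x => ?_
  rw [sec_mul, sec_mul, sec_diag, sec_diag, root_diag, sec_inv]
  rfl

theorem mem_levelStab_succ {k : ℕ} {g : AutT d} :
    g ∈ levelStab d (k + 1) ↔ root g = 1 ∧ ∀ x, sec g x ∈ levelStab d k := by
  rw [mem_levelStab]
  constructor
  · intro H
    have key : ∀ x : Fin d, ∀ u : List (Fin d), u.length = k → root g x = x ∧ (sec g x).1 u = u := by
      intro x u hu
      have := H (x :: u) (by simp [hu])
      rw [apply_cons] at this
      exact List.cons.inj this
    -- Any word of length `k` serves to read off the first letter.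
    exact ⟨Equiv.ext fun x => (key x (List.replicate k x) (by simp)).1,
      fun x u hu => (key x u hu).2⟩
  · rintro ⟨h1, h2⟩ u hu
    cases u with
    | nil => exact apply_nil g
    | cons x w =>
      rw [apply_cons, h1, h2 x w (by simpa using hu)]
      rfl

theorem levelStab_one : levelStab d 1 = (root : AutT d →* _).ker := by
  ext g
  rw [MonoidHom.mem_ker, mem_levelStab_succ, levelStab_zero]
  simp

instance levelStab_normal (k : ℕ) : (levelStab d k).Normal where
  conj_mem n hn g u hu := by
    rw [apply_mul, apply_mul, hn _ (by rw [length_map, hu]), apply_inv_self]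

theorem diag_mem_levelStab_succ {k : ℕ} {f : Fin d → AutT d} :
    diag f ∈ levelStab d (k + 1) ↔ ∀ x, f x ∈ levelStab d k := by
  simp [mem_levelStab_succ]

/-! ### Rotation of the letters -/

section Rotation

theorem finRotate_pow_val (i : Fin d) (n : ℕ) : ((finRotate d ^ n) i).val = (i.val + n) % d := by
  have : NeZero d := ⟨fun h => by subst h; exact i.elim0⟩
  induction n with
  | zero => simp [Nat.mod_eq_of_lt i.2]
  | succ n ih =>
    rw [pow_succ', Equiv.Perm.mul_apply, finRotate_apply, Fin.val_add, ih, ← add_assoc, Fin.val_one']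
    simp

theorem finRotate_pow_self (d : ℕ) : finRotate d ^ d = 1 :=
  Equiv.ext fun i => Fin.ext (by simp [finRotate_pow_val, Nat.mod_eq_of_lt i.2])

theorem exists_finRotate_pow (i j : Fin d) : ∃ n, (finRotate d ^ n) i = j := by
  refine ⟨j.val + (d - i.val), Fin.ext ?_⟩
  rw [finRotate_pow_val]
  have := i.2
  rw [show i.val + (j.val + (d - i.val)) = j.val + d by omega]
  simp [Nat.mod_eq_of_lt j.2]

theorem finRotate_pow_ne (i : Fin d) {n : ℕ} (h0 : 0 < n) (hn : n < d) :
    (finRotate d ^ n) i ≠ i := by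
  intro h
  have h1 := congrArg Fin.val h
  rw [finRotate_pow_val] at h1
  have h2 := i.2
  by_cases h3 : i.val + n < d
  · rw [Nat.mod_eq_of_lt h3] at h1
    omega
  · rw [Nat.mod_eq_sub_mod (by omega), Nat.mod_eq_of_lt (by omega)] at h1
    omega

theorem finRotate_ne (hd : 2 ≤ d) (i : Fin d) : finRotate d i ≠ i := by
  simpa using finRotate_pow_ne i (n := 1) (by omega) (by omega)

end Rotation

/-! ### Generators and the sign invariant -/

theorem gen_mem (i : Fin d) : gen i ∈ G d := Subgroup.subset_closure ⟨i, rfl⟩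

theorem apply_gen_cons (i x : Fin d) (w : List (Fin d)) :
    (gen i).1 (x :: w) =
      letterSwap i x :: (if x = i ∨ x = finRotate d i then genMap x w else w) := rfl

theorem root_gen (i : Fin d) : root (gen i) = Equiv.swap i (finRotate d i) := by
  refine Equiv.ext fun x => ?_
  have := apply_cons (gen i) x []
  rw [apply_gen_cons] at this
  exact (List.cons.inj this).1.symm

theorem sec_gen (i x : Fin d) :
    sec (gen i) x = if x = i ∨ x = finRotate d i then gen x else 1 := by
  refine AutT.ext fun w => ?_
  have := apply_cons (gen i) x w
  rw [apply_gen_cons] at this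
  rw [← (List.cons.inj this).2]
  split_ifs <;> rfl

theorem sec_mem {g : AutT d} (hg : g ∈ G d) : ∀ x, sec g x ∈ G d := by
  refine Subgroup.closure_induction (p := fun g _ => ∀ x, sec g x ∈ G d) ?_ ?_ ?_ ?_ hg
  · rintro _ ⟨i, rfl⟩ x
    rw [sec_gen]
    split_ifs
    exacts [gen_mem x, one_mem _]
  · exact fun x => one_mem _
  · intro g h _ _ hg hh x
    rw [sec_mul]
    exact mul_mem (hg _) (hh _)
  · intro g _ hg x
    rw [sec_inv]
    exact inv_mem (hg _)

/-- The signature of the permutation of the first level. -/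
def sgn : AutT d →* ℤˣ := Equiv.Perm.sign.comp root

theorem sgn_apply (g : AutT d) : sgn g = Equiv.Perm.sign (root g) := rfl

theorem sgn_gen (hd : 2 ≤ d) (i : Fin d) : sgn (gen i) = -1 := by
  rw [sgn_apply, root_gen, Equiv.Perm.sign_swap (finRotate_ne hd i).symm]

/-- A generator has two odd sections and otherwise trivial ones. The product over all letters is
multiplicative because the first factor's sections are merely permuted. -/
theorem prod_sgn_sec (hd : 2 ≤ d) {g : AutT d} (hg : g ∈ G d) : ∏ x, sgn (sec g x) = 1 := by
  refine Subgroup.closure_induction (p := fun g _ => ∏ x, sgn (sec g x) = 1) ?_ ?_ ?_ ?_ hg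
  · rintro _ ⟨i, rfl⟩
    rw [Finset.prod_eq_mul i (finRotate d i) (finRotate_ne hd i).symm]
    · simp [sec_gen, sgn_gen hd]
    · rintro x - ⟨h1, h2⟩
      simp [sec_gen, h1, h2, -finRotate_apply]
    · simp
    · simp
  · simp
  · intro g h _ _ hg hh
    simp only [sec_mul, map_mul, Finset.prod_mul_distrib, hh, mul_one]
    rw [← hg]
    exact Equiv.prod_comp (root h) fun x => sgn (sec g x)
  · intro g _ hg
    simp only [sec_inv, map_inv, Finset.prod_inv_distrib, inv_eq_one]
    rw [← hg]
    exact Equiv.prod_comp (root g)⁻¹ fun x => sgn (sec g x)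

/-! ### Self-replication -/

/-- Some element of `G` maps `i` to `j` with section `u` at `i`. -/
def Carries (i j : Fin d) (u : AutT d) : Prop := ∃ g ∈ G d, root g i = j ∧ sec g i = u

theorem Carries.mul {i j k : Fin d} {u v : AutT d} (hv : Carries j k v) (hu : Carries i j u) :
    Carries i k (v * u) := by
  obtain ⟨g, hg, rfl, rfl⟩ := hu
  obtain ⟨h, hh, rfl, rfl⟩ := hv
  exact ⟨h * g, mul_mem hh hg, by rw [map_mul]; rfl, by rw [sec_mul]⟩

theorem Carries.inv {i j : Fin d} {u : AutT d} (hu : Carries i j u) : Carries j i u⁻¹ := by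
  obtain ⟨g, hg, rfl, rfl⟩ := hu
  have h : root g⁻¹ (root g i) = i := by
    rw [map_inv, Equiv.Perm.inv_eq_iff_eq]
  exact ⟨g⁻¹, inv_mem hg, h, by rw [sec_inv, h]⟩

theorem carries_self_one (i : Fin d) : Carries i i 1 := ⟨1, one_mem _, rfl, rfl⟩

theorem carries_gen (i : Fin d) : Carries i (finRotate d i) (gen i) :=
  ⟨gen i, gen_mem i, by rw [root_gen, Equiv.swap_apply_left], by simp [sec_gen]⟩

theorem carries_gen' (i : Fin d) : Carries (finRotate d i) i (gen (finRotate d i)) :=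
  ⟨gen i, gen_mem i, by rw [root_gen, Equiv.swap_apply_right], by simp [sec_gen]⟩

/-- The label of the path of length `n` that starts at `i` and runs around the cycle. -/
def pathLabel (i : Fin d) : ℕ → AutT d
  | 0 => 1
  | n + 1 => gen ((finRotate d ^ n) i) * pathLabel i n

theorem carries_pathLabel (i : Fin d) (n : ℕ) :
    Carries i ((finRotate d ^ n) i) (pathLabel i n) := by
  induction n with
  | zero => exact carries_self_one i
  | succ n ih =>
    rw [pow_succ', Equiv.Perm.mul_apply]
    exact (carries_gen _).mul ih

/-- Two more steps are gained by running along the path to its end, stepping forward and back there,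
and returning along the path. Prefixed by the loop already found, this loop has the longer label,
since path and inverse cancel. -/
theorem carries_self_pathLabel (i : Fin d) (m : ℕ) : Carries i i (pathLabel i (2 * m)) := by
  induction m with
  | zero => exact carries_self_one i
  | succ m ih =>
    have h1 := carries_pathLabel i (2 * m)
    have h2 : Carries ((finRotate d ^ (2 * m)) i) ((finRotate d ^ (2 * m)) i)
        (gen ((finRotate d ^ (2 * m + 1)) i) * gen ((finRotate d ^ (2 * m)) i)) := by
      rw [pow_succ', Equiv.Perm.mul_apply]
      exact (carries_gen' _).mul (carries_gen _)
    have h3 := ih.mul (h1.inv.mul (h2.mul h1))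
    have h4 : pathLabel i (2 * (m + 1)) = gen ((finRotate d ^ (2 * m + 1)) i) *
        (gen ((finRotate d ^ (2 * m)) i) * pathLabel i (2 * m)) := rfl
    rw [mul_inv_cancel_left, mul_assoc] at h3
    rwa [h4]

/-- For `d = 2m + 1` the path of length `2m` from `i` ends at the predecessor of `i`. Its label also
labels a loop at `i`, and one backward step from `i` reaches the same endpoint with label `gen i`.
Cancelling the path label leaves a loop labelled `gen i`. -/
theorem carries_self_gen (hd : Odd d) (i : Fin d) : Carries i i (gen i) := by
  obtain ⟨m, hm⟩ := hd
  have h1 := carries_self_pathLabel i m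
  have h2 := carries_pathLabel i (2 * m)
  have h3 : finRotate d ((finRotate d ^ (2 * m)) i) = i := by
    rw [← Equiv.Perm.mul_apply, ← pow_succ', ← hm, finRotate_pow_self]
    rfl
  have h4 := carries_gen' ((finRotate d ^ (2 * m)) i)
  rw [h3] at h4
  have h5 := h1.mul (h2.inv.mul h4)
  rwa [mul_inv_cancel_left] at h5

theorem carries_one (hd : Odd d) (i j : Fin d) : Carries i j 1 := by
  obtain ⟨n, rfl⟩ := exists_finRotate_pow i j
  induction n with
  | zero => exact carries_self_one i
  | succ n ih =>
    rw [pow_succ', Equiv.Perm.mul_apply]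
    have h := (carries_gen ((finRotate d ^ n) i)).mul ((carries_self_gen hd _).inv.mul ih)
    rwa [mul_inv_cancel_left] at h

/-- `G` is self-replicating and transitive on the first level. -/
theorem carries_of_mem (hd : Odd d) (i j : Fin d) {u : AutT d} (hu : u ∈ G d) : Carries i j u := by
  have key : Carries i i u := by
    refine Subgroup.closure_induction (p := fun u _ => Carries i i u) ?_ (carries_self_one i)
      (fun u v _ _ hu hv => hu.mul hv) (fun u _ hu => hu.inv) hu
    rintro _ ⟨k, rfl⟩
    have h := (carries_one hd k i).mul ((carries_self_gen hd k).mul (carries_one hd i k))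
    rwa [mul_one, one_mul] at h
  have h := (carries_one hd i j).mul key
  rwa [one_mul] at h

/-- The permutations of the first level fixing `i` that are induced by elements of `G` with trivial
section at `i`. -/
def rootsTrivialAt (i : Fin d) : Subgroup (Equiv.Perm (Fin d)) where
  carrier := {σ | σ i = i ∧ ∃ c ∈ G d, root c = σ ∧ sec c i = 1}
  one_mem' := ⟨rfl, 1, one_mem _, map_one _, rfl⟩
  mul_mem' := by
    rintro _ _ ⟨h1, c, hc, rfl, h2⟩ ⟨h1', c', hc', rfl, h2'⟩
    exact ⟨by rw [Equiv.Perm.mul_apply, h1', h1], c * c', mul_mem hc hc', map_mul _ _ _, by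
      rw [sec_mul, h1', h2, h2', mul_one]⟩
  inv_mem' := by
    rintro _ ⟨h1, c, hc, rfl, h2⟩
    have h3 : (root c)⁻¹ i = i := by rw [Equiv.Perm.inv_eq_iff_eq, h1]
    exact ⟨h3, c⁻¹, inv_mem hc, map_inv _ _, by rw [sec_inv, map_inv, h3, h2, inv_one]⟩

theorem swap_finRotate_mem_rootsTrivialAt {i m : Fin d} (h1 : m ≠ i) (h2 : finRotate d m ≠ i) :
    Equiv.swap m (finRotate d m) ∈ rootsTrivialAt i :=
  ⟨Equiv.swap_apply_of_ne_of_ne h1.symm h2.symm, gen m, gen_mem m, root_gen m, by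
    simp [sec_gen, h1.symm, h2.symm, -finRotate_apply]⟩

/-- Rotation arranges the letters other than `i` in a path, and the generators at its edges have
trivial section at `i`. Conjugating by the next adjacent transposition extends the reach by one
letter. -/
theorem swap_pow_mem_rootsTrivialAt (i : Fin d) (n : ℕ) (hn : n + 1 < d) :
    Equiv.swap (finRotate d i) ((finRotate d ^ (n + 1)) i) ∈ rootsTrivialAt i := by
  induction n with
  | zero =>
    rw [zero_add, pow_one, Equiv.swap_self]
    exact one_mem _
  | succ n ih =>
    have ih := ih (by omega)
    set x := (finRotate d ^ (n + 1)) i with hx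
    have hx' : (finRotate d ^ (n + 1 + 1)) i = finRotate d x := by
      rw [pow_succ', Equiv.Perm.mul_apply]
    have h1 : x ≠ i := finRotate_pow_ne i (by omega) (by omega)
    have h2 : finRotate d x ≠ i := hx' ▸ finRotate_pow_ne i (by omega) hn
    have h3 := swap_finRotate_mem_rootsTrivialAt h1 h2
    rw [hx']
    by_cases h4 : finRotate d i = x
    · rwa [h4]
    · have h5 : finRotate d i ≠ finRotate d x := fun h => h1 ((finRotate d).injective h).symm
      have := mul_mem (mul_mem h3 ih) h3
      rwa [Equiv.swap_mul_swap_mul_swap h4 h5, Equiv.swap_comm] at this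

theorem swap_mem_rootsTrivialAt {i j k : Fin d} (hj : j ≠ i) (hk : k ≠ i) :
    Equiv.swap j k ∈ rootsTrivialAt i := by
  have key : ∀ j, j ≠ i → Equiv.swap (finRotate d i) j ∈ rootsTrivialAt i := by
    intro j hj
    obtain ⟨n, hn⟩ := exists_finRotate_pow i j
    have h1 : (finRotate d ^ (n % d)) i = j := by
      rw [← hn]
      conv_rhs => rw [← Nat.mod_add_div n d, pow_add, pow_mul, finRotate_pow_self, one_pow, mul_one]
    have h2 : n % d < d := Nat.mod_lt _ (Nat.pos_of_ne_zero fun h => by subst h; exact i.elim0)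
    rw [← h1]
    rcases h3 : n % d with _ | m
    · rw [h3] at h1
      exact absurd h1.symm hj
    · exact swap_pow_mem_rootsTrivialAt i m (h3 ▸ h2)
  by_cases h1 : finRotate d i = j
  · exact h1 ▸ key k hk
  by_cases h2 : j = k
  · rw [h2, Equiv.swap_self]
    exact one_mem _
  by_cases h3 : finRotate d i = k
  · rw [Equiv.swap_comm]
    exact h3 ▸ key j hj
  · have := mul_mem (mul_mem (key j hj) (key k hk)) (key j hj)
    rwa [Equiv.swap_comm (finRotate d i) k,
      Equiv.swap_mul_swap_mul_swap (Ne.symm h3) (Ne.symm h2)] at this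

/-- Every permutation fixing `i` is induced by an element of `G` with trivial section at `i`. -/
theorem mem_rootsTrivialAt {i : Fin d} {σ : Equiv.Perm (Fin d)} (h : σ i = i) :
    σ ∈ rootsTrivialAt i := by
  have h1 : (⊤ : Subgroup (Equiv.Perm {x // x ≠ i})).map Equiv.Perm.ofSubtype ≤
      rootsTrivialAt i := by
    rw [← Equiv.Perm.closure_isSwap, MonoidHom.map_closure, Subgroup.closure_le]
    rintro _ ⟨_, ⟨⟨j, hj⟩, ⟨k, hk⟩, -, rfl⟩, rfl⟩
    rw [Equiv.Perm.ofSubtype_swap_eq]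
    exact swap_mem_rootsTrivialAt hj hk
  have h2 : ∀ x, σ x ≠ i ↔ x ≠ i := fun x => not_congr ⟨fun hx => σ.injective (hx.trans h.symm),
    fun hx => by rw [hx, h]⟩
  refine h1 ⟨σ.subtypePerm h2, trivial, ?_⟩
  refine Equiv.Perm.ofSubtype_subtypePerm h2 fun x hx hxi => hx ?_
  rw [hxi, h]

/-- Elements of `G` fixing the first level have arbitrary sections from `G` at a given letter. -/
theorem exists_root_one_sec_eq (hd : Odd d) (i : Fin d) {u : AutT d} (hu : u ∈ G d) :
    ∃ c ∈ G d, root c = 1 ∧ sec c i = u := by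
  obtain ⟨c, hc, h1, h2⟩ := carries_of_mem hd i i hu
  -- `e` has the root permutation of `c` but trivial section at `i`, so dividing by it clears the
  -- root and keeps the section.
  obtain ⟨-, e, he, h3, h4⟩ := mem_rootsTrivialAt h1
  refine ⟨e⁻¹ * c, mul_mem (inv_mem he) hc, by rw [map_mul, map_inv, h3, inv_mul_cancel], ?_⟩
  have h5 : (root e)⁻¹ i = i := by rw [Equiv.Perm.inv_eq_iff_eq, h3, h1]
  rw [sec_mul, h1, h2, sec_inv, map_inv, h5, h4, inv_one, one_mul]

theorem exists_root_eq_sec_eq_one {i j k : Fin d} (hj : j ≠ i) (hk : k ≠ i) :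
    ∃ c ∈ G d, root c i = i ∧ sec c i = 1 ∧ root c j = k := by
  obtain ⟨h1, c, hc, h2, h3⟩ := swap_mem_rootsTrivialAt hj hk
  exact ⟨c, hc, h2 ▸ h1, h3, by rw [h2, Equiv.swap_apply_left]⟩

/-! ### Elements supported on two letters -/

open scoped commutatorElement

/-- The sections at `i` of the elements of `G` that fix the first level and have trivial sections
away from `i` and `j`. -/
def pairSections (i j : Fin d) : Subgroup (AutT d) where
  carrier := {u | ∃ f, diag f ∈ G d ∧ f i = u ∧ ∀ x, x ≠ i → x ≠ j → f x = 1}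
  one_mem' := ⟨1, by rw [map_one]; exact one_mem _, rfl, fun _ _ _ => rfl⟩
  mul_mem' := by
    rintro _ _ ⟨f, hf, rfl, h⟩ ⟨f', hf', rfl, h'⟩
    exact ⟨f * f', by rw [map_mul]; exact mul_mem hf hf', rfl, fun x hi hj => by
      rw [Pi.mul_apply, h x hi hj, h' x hi hj, mul_one]⟩
  inv_mem' := by
    rintro _ ⟨f, hf, rfl, h⟩
    exact ⟨f⁻¹, by rw [map_inv]; exact inv_mem hf, rfl, fun x hi hj => by
      rw [Pi.inv_apply, h x hi hj, inv_one]⟩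

theorem root_inv_apply (c : AutT d) (i : Fin d) : root c⁻¹ (root c i) = i := by
  rw [map_inv, Equiv.Perm.inv_eq_iff_eq]

theorem conj_mem_pairSections {c : AutT d} (hc : c ∈ G d) {i j : Fin d} {u : AutT d}
    (hu : u ∈ pairSections i j) :
    sec c i * u * (sec c i)⁻¹ ∈ pairSections (root c i) (root c j) := by
  obtain ⟨f, hf, rfl, h⟩ := hu
  refine ⟨_, conj_diag c f ▸ mul_mem (mul_mem hc hf) (inv_mem hc), by rw [root_inv_apply], ?_⟩
  intro x hi hj
  have key : ∀ y, x ≠ root c y → root c⁻¹ x ≠ y := by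
    rintro _ hxy rfl
    apply hxy
    rw [map_inv]
    exact (Equiv.apply_symm_apply (root c) x).symm
  rw [h _ (key i hi) (key j hj), mul_one, mul_inv_cancel]

/-- Conjugate by an element that fixes `i` with trivial section there and moves `j` to `k`. -/
theorem pairSections_le {i j k : Fin d} (hj : j ≠ i) (hk : k ≠ i) :
    pairSections i j ≤ pairSections i k := by
  intro u hu
  obtain ⟨c, hc, h1, h2, h3⟩ := exists_root_eq_sec_eq_one hj hk
  have h4 := conj_mem_pairSections hc hu
  rwa [h1, h2, h3, one_mul, inv_one, mul_one] at h4

theorem pairSections_le_of_ne (hd : Odd d) {i j k l : Fin d} (hij : i ≠ j) (hkl : k ≠ l) :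
    pairSections i j ≤ pairSections k l := by
  intro u hu
  obtain ⟨c, hc, h1, h2⟩ := carries_one hd i k
  have h4 := conj_mem_pairSections hc hu
  rw [h1, h2, one_mul, inv_one, mul_one] at h4
  refine pairSections_le (fun h => hij ?_) hkl.symm h4
  exact (root c).injective (h1.trans h.symm)

theorem conj_mem_pairSections_self (hd : Odd d) {i j : Fin d} {u w : AutT d}
    (hu : u ∈ pairSections i j) (hw : w ∈ G d) : w * u * w⁻¹ ∈ pairSections i j := by
  obtain ⟨c, hc, h1, rfl⟩ := exists_root_one_sec_eq hd i hw
  simpa [h1] using conj_mem_pairSections hc hu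

/-- The square of `gen k` fixes the first level and is supported on `k` and its successor; this
product is its section at `k`. -/
theorem gen_mul_gen_mem_pairSections (hd : Odd d) (h2 : 2 ≤ d) {i j : Fin d} (hij : i ≠ j)
    (k : Fin d) : gen (finRotate d k) * gen k ∈ pairSections i j := by
  have hk := finRotate_ne h2 k
  refine pairSections_le_of_ne hd hk.symm hij ⟨sec (gen k * gen k), ?_, ?_, ?_⟩
  · rw [diag_sec (by rw [map_mul, root_gen, Equiv.swap_mul_self])]
    exact mul_mem (gen_mem k) (gen_mem k)
  · rw [sec_mul, root_gen, Equiv.swap_apply_left, sec_gen, sec_gen, if_pos (Or.inr rfl),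
      if_pos (Or.inl rfl)]
  · intro x h1 h2
    rw [sec_mul, root_gen, Equiv.swap_apply_of_ne_of_ne h1 h2, sec_gen, if_neg (by tauto), mul_one]

theorem gen_mul_inv_gen_mem_pairSections_aux (hd : Odd d) (h2 : 2 ≤ d) {i j : Fin d} (hij : i ≠ j)
    (k : Fin d) (n : ℕ) :
    gen ((finRotate d ^ (2 * n)) k) * (gen k)⁻¹ ∈ pairSections i j := by
  induction n with
  | zero => simp
  | succ n ih =>
    set m := (finRotate d ^ (2 * n)) k
    have hm : (finRotate d ^ (2 * (n + 1))) k = finRotate d (finRotate d m) := by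
      rw [← Equiv.Perm.mul_apply, ← Equiv.Perm.mul_apply, mul_add, pow_add, mul_one, pow_two,
        ← pow_two, ← pow_add, add_comm, pow_add, pow_two]
    -- With m+1, m+2 the successors of m: a_{m+2} a_m⁻¹ = (a_{m+2} a_{m+1}) · (a_m (a_{m+1} a_m)
    -- a_m⁻¹)⁻¹.
    have h3 := gen_mul_gen_mem_pairSections hd h2 hij (finRotate d m)
    have h4 := inv_mem (conj_mem_pairSections_self hd
      (gen_mul_gen_mem_pairSections hd h2 hij m) (gen_mem m))
    have h5 := mul_mem (mul_mem h3 h4) ih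
    rw [hm]
    convert h5 using 1
    group

theorem gen_mul_inv_gen_mem_pairSections (hd : Odd d) (h2 : 2 ≤ d) {i j : Fin d} (hij : i ≠ j)
    (k l : Fin d) : gen l * (gen k)⁻¹ ∈ pairSections i j := by
  obtain ⟨n, rfl⟩ := exists_finRotate_pow k l
  obtain ⟨m, hm⟩ := hd
  rcases Nat.even_or_odd n with ⟨a, ha⟩ | ⟨a, ha⟩
  · rw [ha, ← two_mul]
    exact gen_mul_inv_gen_mem_pairSections_aux ⟨m, hm⟩ h2 hij k a
  -- Since `d` is odd, one extra turn around the cycle makes an odd number of steps even.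
  · have h := gen_mul_inv_gen_mem_pairSections_aux ⟨m, hm⟩ h2 hij k (a + m + 1)
    rwa [show 2 * (a + m + 1) = n + d by omega, pow_add, finRotate_pow_self, mul_one] at h

theorem gen_mul_self_mem_pairSections (hd : Odd d) (h2 : 2 ≤ d) {i j : Fin d} (hij : i ≠ j)
    (k : Fin d) : gen k * gen k ∈ pairSections i j := by
  have h := mul_mem (inv_mem (gen_mul_inv_gen_mem_pairSections hd h2 hij k (finRotate d k)))
    (gen_mul_gen_mem_pairSections hd h2 hij k)
  convert h using 1
  group

/-- Modulo `pairSections i j`, which `G` normalizes, all generators coincide and have trivial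
square. At most two classes remain, and the sign tells them apart. -/
theorem mem_pairSections_or (hd : Odd d) (h2 : 2 ≤ d) {i j : Fin d} (hij : i ≠ j) (k : Fin d)
    {g : AutT d} (hg : g ∈ G d) :
    sgn g = 1 ∧ g ∈ pairSections i j ∨ sgn g = -1 ∧ g * (gen k)⁻¹ ∈ pairSections i j := by
  have hk := gen_mul_self_mem_pairSections hd h2 hij k
  have hc := fun u (hu : u ∈ pairSections i j) =>
    conj_mem_pairSections_self hd hu (gen_mem k)
  refine Subgroup.closure_induction (p := fun g _ => sgn g = 1 ∧ g ∈ pairSections i j ∨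
    sgn g = -1 ∧ g * (gen k)⁻¹ ∈ pairSections i j) ?_ ?_ ?_ ?_ hg
  · rintro _ ⟨l, rfl⟩
    exact Or.inr ⟨sgn_gen h2 l, gen_mul_inv_gen_mem_pairSections hd h2 hij k l⟩
  · exact Or.inl ⟨map_one _, one_mem _⟩
  · rintro g h - - (⟨hg, hg'⟩ | ⟨hg, hg'⟩) (⟨hh, hh'⟩ | ⟨hh, hh'⟩)
    · exact Or.inl ⟨by simp [hg, hh], mul_mem hg' hh'⟩
    · refine Or.inr ⟨by simp [hg, hh], ?_⟩
      rw [mul_assoc]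
      exact mul_mem hg' hh'
    · refine Or.inr ⟨by simp [hg, hh], ?_⟩
      convert mul_mem hg' (hc _ hh') using 1
      group
    · refine Or.inl ⟨by simp [hg, hh], ?_⟩
      convert mul_mem (mul_mem hg' (hc _ hh')) hk using 1
      group
  · rintro g - (⟨hg, hg'⟩ | ⟨hg, hg'⟩)
    · exact Or.inl ⟨by simp [hg], inv_mem hg'⟩
    · refine Or.inr ⟨by simp [hg], ?_⟩
      convert inv_mem (mul_mem (hc _ hg') hk) using 1
      group

theorem mem_pairSections_of_sgn (hd : Odd d) (h2 : 2 ≤ d) {i j : Fin d} (hij : i ≠ j)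
    {g : AutT d} (hg : g ∈ G d) (hs : sgn g = 1) : g ∈ pairSections i j := by
  rcases mem_pairSections_or hd h2 hij i hg with ⟨-, h⟩ | ⟨h, -⟩
  · exact h
  · rw [hs] at h
    exact absurd h (by decide)

/-! ### Branching over the commutator subgroup -/

/-- The elements whose copy at the letter `i` lies in `G`. -/
def rist (i : Fin d) : Subgroup (AutT d) :=
  (G d).comap (diag.comp (MonoidHom.mulSingle (fun _ => AutT d) i))

theorem mem_rist {i : Fin d} {u : AutT d} : u ∈ rist i ↔ diag (Pi.mulSingle i u) ∈ G d := Iff.rfl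

theorem conj_mem_rist {i j : Fin d} (hd : Odd d) {u w : AutT d} (hu : u ∈ rist i)
    (hw : w ∈ G d) : w * u * w⁻¹ ∈ rist j := by
  obtain ⟨c, hc, rfl, rfl⟩ := carries_of_mem hd i j hw
  rw [mem_rist] at hu ⊢
  have h := mul_mem (mul_mem hc hu) (inv_mem hc)
  rw [conj_diag] at h
  convert h using 2
  funext x
  by_cases hx : x = root c i
  · rw [hx, Pi.mulSingle_eq_same, root_inv_apply, Pi.mulSingle_eq_same]
  · have hx' : root c⁻¹ x ≠ i := by
      rintro rfl
      apply hx
      rw [map_inv]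
      exact (Equiv.apply_symm_apply (root c) x).symm
    rw [Pi.mulSingle_eq_of_ne hx, Pi.mulSingle_eq_of_ne hx', mul_one, mul_inv_cancel]

theorem mulSingle_commutator {i : Fin d} {f f' : Fin d → AutT d}
    (h : ∀ x, x ≠ i → f x = 1 ∨ f' x = 1) : Pi.mulSingle i ⁅f i, f' i⁆ = ⁅f, f'⁆ := by
  funext x
  by_cases hx : x = i
  · subst hx
    rw [Pi.mulSingle_eq_same]
    rfl
  · rw [Pi.mulSingle_eq_of_ne hx]
    change 1 = ⁅f x, f' x⁆
    rcases h x hx with h | h <;> simp [h, commutatorElement_def]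

theorem commutator_mem {g h : AutT d} (H : Subgroup (AutT d)) (hg : g ∈ H) (hh : h ∈ H) :
    ⁅g, h⁆ ∈ H := by
  rw [commutatorElement_def]
  exact mul_mem (mul_mem (mul_mem hg hh) (inv_mem hg)) (inv_mem hh)

/-- The supports {i, j} and {i, k} meet only in `i`. -/
theorem commutator_mem_rist {i j k : Fin d} (hjk : j ≠ k) {u v : AutT d}
    (hu : u ∈ pairSections i j) (hv : v ∈ pairSections i k) : ⁅u, v⁆ ∈ rist i := by
  obtain ⟨f, hf, rfl, h⟩ := hu
  obtain ⟨f', hf', rfl, h'⟩ := hv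
  rw [mem_rist, mulSingle_commutator, map_commutatorElement]
  · exact commutator_mem _ hf hf'
  · intro x hx
    by_cases hxj : x = j
    · exact Or.inr (h' x hx (hxj ▸ hjk))
    · exact Or.inl (h x hx hxj)

theorem exists_ne_ne (h3 : 3 ≤ d) (i j : Fin d) : ∃ k : Fin d, k ≠ i ∧ k ≠ j := by
  have : ∃ k ∈ (Finset.univ : Finset (Fin d)), k ∉ ({i, j} : Finset (Fin d)) := by
    refine Finset.exists_mem_notMem_of_card_lt_card ?_
    rw [Finset.card_univ, Fintype.card_fin]
    exact lt_of_le_of_lt Finset.card_le_two h3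
  obtain ⟨k, -, hk⟩ := this
  simp only [Finset.mem_insert, Finset.mem_singleton, not_or] at hk
  exact ⟨k, hk⟩

theorem commutator_mem_rist_of_sgn (hd : Odd d) (h3 : 3 ≤ d) (i : Fin d) {u v : AutT d}
    (hu : u ∈ G d) (hv : v ∈ G d) (hsu : sgn u = 1) (hsv : sgn v = 1) : ⁅u, v⁆ ∈ rist i := by
  obtain ⟨j, hj, -⟩ := exists_ne_ne h3 i i
  obtain ⟨k, hk, hjk⟩ := exists_ne_ne h3 i j
  exact commutator_mem_rist hjk.symm (mem_pairSections_of_sgn hd (by omega) hj.symm hu hsu)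
    (mem_pairSections_of_sgn hd (by omega) hk.symm hv hsv)

theorem int_units_eq_neg_one {s : ℤˣ} (h : s ≠ 1) : s = -1 :=
  (Int.units_eq_one_or s).resolve_left h

/-- There is an element of `G` fixing the first level with a prescribed odd section at `i` and an
even section at some other letter. -/
theorem exists_sec_odd_even (hd : Odd d) (h2 : 2 ≤ d) (i : Fin d) {w : AutT d} (hw : w ∈ G d)
    (hs : sgn w = -1) :
    ∃ c ∈ G d, root c = 1 ∧ sec c i = w ∧ ∃ j ≠ i, sgn (sec c j) = 1 := by
  obtain ⟨c, hc, h1, rfl⟩ := exists_root_one_sec_eq hd i hw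
  refine ⟨c, hc, h1, rfl, ?_⟩
  by_contra! H
  -- Otherwise all `d` sections are odd, and their signs multiply to -1.
  have h3 : ∀ j, sgn (sec c j) = -1 := by
    intro j
    by_cases hj : j = i
    · rw [hj, hs]
    · exact int_units_eq_neg_one (H j hj)
  have h4 := prod_sgn_sec h2 hc
  simp only [h3, Finset.prod_const, Finset.card_univ, Fintype.card_fin, hd.neg_one_pow] at h4
  exact absurd h4 (by decide)

/-- For odd `w`, take `c` with section `w` at `i` and an even section at some `j`, and `f` supported
on `i` and `j` with `f i = u`. Their commutator is supported on `i` and `j`; its part at `j` is a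
commutator of even elements, hence can be divided out by the even case. -/
theorem commutator_mem_rist_of_sgn_right (hd : Odd d) (h3 : 3 ≤ d) (i : Fin d) {u w : AutT d}
    (hw : w ∈ G d) (hu : u ∈ G d) (hsu : sgn u = 1) : ⁅w, u⁆ ∈ rist i := by
  rcases Int.units_eq_one_or (sgn w) with hsw | hsw
  · exact commutator_mem_rist_of_sgn hd h3 i hw hu hsw hsu
  obtain ⟨c, hc, h1, rfl, j, hj, h4⟩ := exists_sec_odd_even hd (by omega) i hw hsw
  obtain ⟨f, hf, rfl, h⟩ := mem_pairSections_of_sgn hd (by omega) hj.symm hu hsu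
  have hfG : ∀ x, f x ∈ G d := fun x => by simpa using sec_mem hf x
  have hfj : sgn (f j) = 1 := by
    have h5 := prod_sgn_sec (by omega) hf
    rw [Finset.prod_eq_mul i j hj.symm] at h5
    · simpa [hsu] using h5
    · rintro x - ⟨hxi, hxj⟩
      simp [h x hxi hxj]
    · simp
    · simp
  have h6 : ⁅sec c j, f j⁆ ∈ rist j :=
    commutator_mem_rist_of_sgn hd h3 j (sec_mem hc j) (hfG j) h4 hfj
  have h7 : diag ⁅sec c, f⁆ ∈ G d := by
    rw [map_commutatorElement, diag_sec h1]
    exact commutator_mem _ hc hf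
  have h8 : (Pi.mulSingle i ⁅sec c i, f i⁆ : Fin d → AutT d) =
      ⁅sec c, f⁆ * (Pi.mulSingle j ⁅sec c j, f j⁆)⁻¹ := by
    funext x
    rw [Pi.mul_apply, Pi.inv_apply]
    change _ = ⁅sec c x, f x⁆ * _
    by_cases hxi : x = i
    · subst hxi
      rw [Pi.mulSingle_eq_same, Pi.mulSingle_eq_of_ne hj.symm, inv_one, mul_one]
    · rw [Pi.mulSingle_eq_of_ne hxi]
      by_cases hxj : x = j
      · subst hxj
        rw [Pi.mulSingle_eq_same, mul_inv_cancel]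
      · rw [Pi.mulSingle_eq_of_ne hxj, h x hxi hxj]
        simp
  rw [mem_rist, h8, map_mul, map_inv]
  exact mul_mem h7 (inv_mem h6)

/-- `G` is weakly regular branch over its commutator subgroup. -/
theorem commutator_le_rist (hd : Odd d) (h3 : 3 ≤ d) (i : Fin d) : ⁅G d, G d⁆ ≤ rist i := by
  rw [Subgroup.commutator_le]
  intro g hg h hh
  rcases Int.units_eq_one_or (sgn h) with hsh | hsh
  · exact commutator_mem_rist_of_sgn_right hd h3 i hg hh hsh
  rcases Int.units_eq_one_or (sgn g) with hsg | hsg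
  · rw [← commutatorElement_inv]
    exact inv_mem (commutator_mem_rist_of_sgn_right hd h3 i hh hg hsg)
  -- When both are odd, h⁻¹g is even and [g, h] = (h [h, h⁻¹g] h⁻¹)⁻¹.
  have he := commutator_mem_rist_of_sgn_right hd h3 i hh (mul_mem (inv_mem hh) hg)
    (by simp [hsg, hsh])
  have h5 := inv_mem (conj_mem_rist (j := i) hd he hh)
  convert h5 using 1
  simp only [commutatorElement_def]
  group

/-! ### Root permutations and sign patterns of commutators -/

/-- Three-cycles generate the alternating group. If σ = st is one, with s and t transpositions, then
σ² = [s, t] and σ = (σ²)². -/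
theorem mem_commutator_of_sign_eq_one {α : Type*} [Fintype α] [DecidableEq α] {σ : Equiv.Perm α}
    (h : Equiv.Perm.sign σ = 1) : σ ∈ ⁅(⊤ : Subgroup (Equiv.Perm α)), (⊤ : Subgroup (Equiv.Perm α))⁆ := by
  suffices H : alternatingGroup α ≤ ⁅(⊤ : Subgroup (Equiv.Perm α)), (⊤ : Subgroup (Equiv.Perm α))⁆ from
    H (Equiv.Perm.mem_alternatingGroup.2 h)
  rw [← Equiv.Perm.closure_three_cycles_eq_alternating, Subgroup.closure_le]
  intro σ (hσ : σ.IsThreeCycle)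
  obtain ⟨a, ha⟩ : σ.support.Nonempty := by
    rw [← Finset.card_pos, hσ.card_support]
    decide
  have h1 : σ * σ ∈ ⁅(⊤ : Subgroup (Equiv.Perm α)), (⊤ : Subgroup (Equiv.Perm α))⁆ := by
    rw [hσ.eq_swap_mul_swap_iff_mem_support.2 ha]
    have h2 := Subgroup.commutator_mem_commutator (Subgroup.mem_top (Equiv.swap a (σ a)))
      (Subgroup.mem_top (Equiv.swap (σ a) (σ (σ a))))
    rwa [commutatorElement_def, Equiv.swap_inv, Equiv.swap_inv, mul_assoc] at h2
  have h3 : σ * σ * σ = 1 := by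
    have := pow_orderOf_eq_one σ
    rwa [hσ.orderOf, pow_succ, pow_two] at this
  have h4 := mul_mem h1 h1
  rwa [← mul_assoc, h3, one_mul] at h4

theorem map_root_G (hd : Odd d) : (G d).map root = ⊤ := by
  rw [eq_top_iff]
  intro σ _
  have i : Fin d := ⟨0, hd.pos⟩
  obtain ⟨c, hc, h1, -⟩ := carries_one hd i (σ i)
  have h2 : ((root c)⁻¹ * σ) i = i := by
    rw [Equiv.Perm.mul_apply, Equiv.Perm.inv_eq_iff_eq, h1]
  obtain ⟨-, e, he, h3, -⟩ := mem_rootsTrivialAt h2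
  exact ⟨c * e, mul_mem hc he, by rw [map_mul, h3, mul_inv_cancel_left]⟩

theorem exists_mem_commutator_root_eq (hd : Odd d) {σ : Equiv.Perm (Fin d)}
    (h : Equiv.Perm.sign σ = 1) : ∃ g ∈ ⁅G d, G d⁆, root g = σ := by
  have h1 := mem_commutator_of_sign_eq_one h
  rwa [← map_root_G hd, ← Subgroup.map_commutator] at h1

theorem commutator_le_G : ⁅G d, G d⁆ ≤ G d :=
  Subgroup.commutator_le.2 fun _ hg _ hh => commutator_mem _ hg hh

/-- The sign patterns on the first level of the elements of the commutator subgroup that fix the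
first level. -/
def signPatterns (d : ℕ) : Subgroup (Fin d → ℤˣ) where
  carrier := {s | ∃ p ∈ ⁅G d, G d⁆, root p = 1 ∧ ∀ x, sgn (sec p x) = s x}
  one_mem' := ⟨1, one_mem _, map_one _, fun x => by rw [sec_one, map_one]; rfl⟩
  mul_mem' := by
    rintro _ _ ⟨p, hp, h1, h2⟩ ⟨q, hq, h3, h4⟩
    refine ⟨p * q, mul_mem hp hq, by rw [map_mul, h1, h3, mul_one], fun x => ?_⟩
    rw [sec_mul, map_mul, h3, Equiv.Perm.one_apply, h2, h4]
    rfl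
  inv_mem' := by
    rintro _ ⟨p, hp, h1, h2⟩
    refine ⟨p⁻¹, inv_mem hp, by rw [map_inv, h1, inv_one], fun x => ?_⟩
    rw [sec_inv, map_inv, map_inv, h1, inv_one, Equiv.Perm.one_apply, h2]
    rfl

theorem sgn_sec_conj {c p : AutT d} (hp : root p = 1) (x : Fin d) :
    sgn (sec (c * p * c⁻¹) x) = sgn (sec p (root c⁻¹ x)) := by
  rw [← diag_sec hp, conj_diag, sec_diag, map_mul, map_mul, map_inv sgn, mul_comm, ← mul_assoc,
    inv_mul_cancel, one_mul, sec_diag]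

/-- Take `c` fixing the first level, odd at `i` and even at `j`, and `t` inducing the swap of `i`
and `j`. The sign of [c, t] at a letter is the sign of `c` there times its sign at the swapped
letter, so exactly `i` and `j` become odd. -/
theorem mulSingle_mul_mulSingle_mem_signPatterns (hd : Odd d) (h2 : 2 ≤ d) {i j : Fin d}
    (hij : j ≠ i) :
    (Pi.mulSingle i (-1) * Pi.mulSingle j (-1) : Fin d → ℤˣ) ∈ signPatterns d := by
  obtain ⟨c₀, hc₀, h1, h3, k, hk, h4⟩ := exists_sec_odd_even hd h2 i (gen_mem i) (sgn_gen h2 i)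
  -- The even letter `k` is not under control; conjugation by `e` moves it to `j` and fixes `i`.
  obtain ⟨e, he, h5, -, h7⟩ := exists_root_eq_sec_eq_one hk hij
  set c := e * c₀ * e⁻¹
  have hc : c ∈ G d := mul_mem (mul_mem he hc₀) (inv_mem he)
  have hc1 : root c = 1 := by rw [map_mul, map_mul, h1, mul_one, ← map_mul, mul_inv_cancel, map_one]
  have hci : sgn (sec c i) = -1 := by
    rw [sgn_sec_conj h1, show root e⁻¹ i = i by rw [map_inv, Equiv.Perm.inv_eq_iff_eq, h5], h3,
      sgn_gen h2]
  have hcj : sgn (sec c j) = 1 := by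
    rw [sgn_sec_conj h1, show root e⁻¹ j = k by rw [map_inv, Equiv.Perm.inv_eq_iff_eq, h7], h4]
  obtain ⟨t, ht, hts⟩ : Equiv.swap i j ∈ (G d).map root := by
    rw [map_root_G hd]
    trivial
  have hcinv : root c⁻¹ = 1 := by rw [map_inv, hc1, inv_one]
  refine ⟨⁅c, t⁆, Subgroup.commutator_mem_commutator hc ht, ?_, fun x => ?_⟩
  · rw [commutatorElement_def]
    simp [hc1]
  · rw [commutatorElement_def, mul_assoc, mul_assoc, ← mul_assoc t, sec_mul, map_mul,
      sgn_sec_conj hcinv, sec_inv, map_inv sgn, hcinv, Equiv.Perm.one_apply, Int.units_inv_eq_self,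
      map_mul root, map_mul root, hcinv, mul_one, ← map_mul root, mul_inv_cancel, map_one,
      Equiv.Perm.one_apply, map_inv, hts, Equiv.swap_inv, Pi.mul_apply]
    by_cases hxi : x = i
    · subst hxi
      rw [Equiv.swap_apply_left, hci, hcj, Pi.mulSingle_eq_same, Pi.mulSingle_eq_of_ne hij.symm]
    by_cases hxj : x = j
    · subst hxj
      rw [Equiv.swap_apply_right, hci, hcj, Pi.mulSingle_eq_same, Pi.mulSingle_eq_of_ne hij]
    · rw [Equiv.swap_apply_of_ne_of_ne hxi hxj, Int.units_mul_self, Pi.mulSingle_eq_of_ne hxi,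
        Pi.mulSingle_eq_of_ne hxj, mul_one]

theorem mem_signPatterns (hd : Odd d) (h2 : 2 ≤ d) {s : Fin d → ℤˣ} (hs : ∏ x, s x = 1) :
    s ∈ signPatterns d := by
  have i : Fin d := ⟨0, hd.pos⟩
  -- Because the signs multiply to 1, the compensating factors at `i` cancel.
  have h1 : ∏ x, (Pi.mulSingle i (s x) * Pi.mulSingle x (s x) : Fin d → ℤˣ) = s := by
    rw [Finset.prod_mul_distrib, Finset.univ_prod_mulSingle]
    have := map_prod (MonoidHom.mulSingle (fun _ : Fin d => ℤˣ) i) s Finset.univ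
    rw [hs, map_one] at this
    exact (congrArg (· * s) this.symm).trans (one_mul s)
  rw [← h1]
  refine Subgroup.prod_mem _ fun x _ => ?_
  rcases Int.units_eq_one_or (s x) with h | h
  · simp [h]
  · rw [h]
    by_cases hx : x = i
    · rw [hx, ← Pi.mulSingle_mul, Int.units_mul_self, Pi.mulSingle_one]
      exact one_mem _
    · exact mulSingle_mul_mulSingle_mem_signPatterns hd h2 hx

/-! ### Even elements modulo level stabilizers -/

/-- Modulo the `k`-th level stabilizer, the even elements of `G` lie in the commutator subgroup. -/
def EvenInCommutator (d k : ℕ) : Prop :=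
  ∀ g ∈ G d, sgn g = 1 → g ∈ ⁅G d, G d⁆ ⊔ levelStab d k

theorem diag_mem_of_mem_commutator (hd : Odd d) (h3 : 3 ≤ d) {f : Fin d → AutT d}
    (hf : ∀ x, f x ∈ ⁅G d, G d⁆) : diag f ∈ G d :=
  Subgroup.pi_mem_of_mulSingle_mem (H := (G d).comap diag) f fun x =>
    commutator_le_rist hd h3 x (hf x)

theorem EvenInCommutator.exists_commutator {k : ℕ} (H : EvenInCommutator d k)
    {f : Fin d → AutT d} (hf : ∀ x, f x ∈ G d) (hs : ∀ x, sgn (f x) = 1) :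
    ∃ h : Fin d → AutT d, (∀ x, h x ∈ ⁅G d, G d⁆) ∧ (diag h)⁻¹ * diag f ∈ levelStab d (k + 1) := by
  have h1 : ∀ x, ∃ h ∈ ⁅G d, G d⁆, h⁻¹ * f x ∈ levelStab d k := by
    intro x
    obtain ⟨y, hy, z, hz, h⟩ := Subgroup.mem_sup_of_normal_right.1 (H (f x) (hf x) (hs x))
    exact ⟨y, hy, by rwa [← h, inv_mul_cancel_left]⟩
  choose h hh hh' using h1
  refine ⟨h, hh, ?_⟩
  rw [← map_inv, ← map_mul, diag_mem_levelStab_succ]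
  exact hh'

/-- The sign condition is the only obstruction: dividing by a product of commutators `p` with the
same signs leaves even sections. These agree with elements of the commutator subgroup to depth `k`,
and tuples of such elements lie in `G` by branching. -/
theorem EvenInCommutator.exists_sec_eq {k : ℕ} (H : EvenInCommutator d k) (hd : Odd d) (h3 : 3 ≤ d)
    {f : Fin d → AutT d} (hf : ∀ x, f x ∈ G d) (hs : ∏ x, sgn (f x) = 1) :
    ∃ h : Fin d → AutT d, diag h ∈ G d ∧ (diag h)⁻¹ * diag f ∈ levelStab d (k + 1) := by
  obtain ⟨p, hp, hp1, hps⟩ := mem_signPatterns hd (by omega) hs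
  have hpG := commutator_le_G hp
  obtain ⟨h, hh, hh'⟩ := H.exists_commutator (f := fun x => (sec p x)⁻¹ * f x)
    (fun x => mul_mem (inv_mem (sec_mem hpG x)) (hf x)) (fun x => by simp [hps])
  refine ⟨sec p * h, ?_, ?_⟩
  · rw [map_mul, diag_sec hp1]
    exact mul_mem hpG (diag_mem_of_mem_commutator hd h3 hh)
  · have h4 : diag (fun x => (sec p x)⁻¹ * f x) = (diag (sec p))⁻¹ * diag f := by
      rw [← map_inv, ← map_mul]
      rfl
    rw [h4] at hh'
    rwa [map_mul, mul_inv_rev, mul_assoc]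

/-- Branching only places this element in `G`. To reach the commutator subgroup, `g` is put at `i`
and `j`, and `h` at `i` and `l`, with three distinct letters. Both tuples have sign product 1, so
`G` realises them to depth `k + 1`, and their commutator is [g, h] at `i` alone. -/
theorem EvenInCommutator.diag_mulSingle_mem {k : ℕ} (H : EvenInCommutator d k) (hd : Odd d)
    (h3 : 3 ≤ d) (i : Fin d) {u : AutT d} (hu : u ∈ ⁅G d, G d⁆) :
    diag (Pi.mulSingle i u) ∈ ⁅G d, G d⁆ ⊔ levelStab d (k + 1) := by
  suffices h : ⁅G d, G d⁆ ≤ (⁅G d, G d⁆ ⊔ levelStab d (k + 1)).comap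
      (diag.comp (MonoidHom.mulSingle (fun _ => AutT d) i)) from h hu
  rw [Subgroup.commutator_le]
  intro g hg h hh
  obtain ⟨j, hj, -⟩ := exists_ne_ne h3 i i
  obtain ⟨l, hl, hlj⟩ := exists_ne_ne h3 i j
  have key : ∀ (m : Fin d), m ≠ i → ∀ u ∈ G d,
      ∃ c ∈ G d, c⁻¹ * diag (Pi.mulSingle i u * Pi.mulSingle m u) ∈ levelStab d (k + 1) := by
    intro m hm u hu
    obtain ⟨f, hf, hf'⟩ := H.exists_sec_eq hd h3
      (f := (Pi.mulSingle i u * Pi.mulSingle m u : Fin d → AutT d))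
      (fun x => by
        refine mul_mem ?_ ?_
        · by_cases hx : x = i
          · subst hx; rwa [Pi.mulSingle_eq_same]
          · rw [Pi.mulSingle_eq_of_ne hx]; exact one_mem _
        · by_cases hx : x = m
          · subst hx; rwa [Pi.mulSingle_eq_same]
          · rw [Pi.mulSingle_eq_of_ne hx]; exact one_mem _)
      (by
        rw [Finset.prod_eq_mul i m hm.symm]
        · simp [Pi.mulSingle_eq_of_ne hm, Pi.mulSingle_eq_of_ne hm.symm]
        · rintro x - ⟨h1, h2⟩
          simp [Pi.mulSingle_eq_of_ne h1, Pi.mulSingle_eq_of_ne h2]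
        · simp
        · simp)
    exact ⟨_, hf, hf'⟩
  obtain ⟨c, hc, hc'⟩ := key j hj g hg
  obtain ⟨e, he, he'⟩ := key l hl h hh
  have h4 : (Pi.mulSingle i ⁅g, h⁆ : Fin d → AutT d) =
      ⁅(Pi.mulSingle i g * Pi.mulSingle j g : Fin d → AutT d),
        Pi.mulSingle i h * Pi.mulSingle l h⁆ := by
    have h5 := mulSingle_commutator (i := i)
      (f := (Pi.mulSingle i g * Pi.mulSingle j g : Fin d → AutT d))
      (f' := (Pi.mulSingle i h * Pi.mulSingle l h : Fin d → AutT d)) ?_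
    · rw [← h5]
      simp [Pi.mulSingle_eq_of_ne hj.symm, Pi.mulSingle_eq_of_ne hl.symm]
    · intro x hx
      by_cases hxj : x = j
      · right
        have : x ≠ l := fun h => hlj (h ▸ hxj)
        simp [Pi.mulSingle_eq_of_ne hx, Pi.mulSingle_eq_of_ne this]
      · left
        simp [Pi.mulSingle_eq_of_ne hx, Pi.mulSingle_eq_of_ne hxj]
  change diag (Pi.mulSingle i ⁅g, h⁆ : Fin d → AutT d) ∈ ⁅G d, G d⁆ ⊔ levelStab d (k + 1)
  rw [h4, map_commutatorElement]
  refine Subgroup.mem_sup_of_normal_right.2 ⟨⁅c, e⁆, Subgroup.commutator_mem_commutator hc he, _,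
    ?_, mul_inv_cancel_left _ _⟩
  rw [← QuotientGroup.eq] at hc' he' ⊢
  have h5 : ∀ a b : AutT d, ((⁅a, b⁆ : AutT d) : AutT d ⧸ levelStab d (k + 1)) =
    ⁅(a : AutT d ⧸ levelStab d (k + 1)), (b : AutT d ⧸ levelStab d (k + 1))⁆ := fun _ _ => rfl
  rw [h5, h5, hc', he']

/-- Elements of the commutator subgroup remove first the even root permutation and then the signs of
the sections. The remaining sections are even, hence congruent to elements of the commutator
subgroup, whose copies at single letters were just handled. -/
theorem EvenInCommutator.succ {k : ℕ} (H : EvenInCommutator d k) (hd : Odd d) (h3 : 3 ≤ d) :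
    EvenInCommutator d (k + 1) := by
  intro g hg hs
  obtain ⟨q, hq, hqr⟩ := exists_mem_commutator_root_eq hd (σ := root g) hs
  have hg₁ : q⁻¹ * g ∈ G d := mul_mem (inv_mem (commutator_le_G hq)) hg
  have hr₁ : root (q⁻¹ * g) = 1 := by rw [map_mul, map_inv, hqr, inv_mul_cancel]
  obtain ⟨p, hp, hp1, hps⟩ := mem_signPatterns hd (by omega) (prod_sgn_sec (by omega) hg₁)
  set g₂ := p⁻¹ * (q⁻¹ * g) with hg₂_def
  have hg₂ : g₂ ∈ G d := mul_mem (inv_mem (commutator_le_G hp)) hg₁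
  have hr₂ : root g₂ = 1 := by rw [map_mul, hr₁, map_inv, hp1, inv_one, mul_one]
  obtain ⟨h, hh, hh'⟩ := H.exists_commutator (f := sec g₂) (sec_mem hg₂) (fun x => by
    rw [hg₂_def, sec_mul, map_mul, sec_inv, map_inv, map_inv, hp1, inv_one, hr₁,
      Equiv.Perm.one_apply]
    exact mul_eq_one_iff_inv_eq.2 ((inv_inv _).trans (hps x)))
  rw [diag_sec hr₂] at hh'
  have h4 : diag h ∈ ⁅G d, G d⁆ ⊔ levelStab d (k + 1) :=
    Subgroup.pi_mem_of_mulSingle_mem (H := (⁅G d, G d⁆ ⊔ levelStab d (k + 1)).comap diag) h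
      fun x => H.diag_mulSingle_mem hd h3 x (hh x)
  have h5 := mul_mem (Subgroup.mem_sup_left hq) (mul_mem (Subgroup.mem_sup_left hp)
    (mul_mem h4 (Subgroup.mem_sup_right hh')))
  rwa [mul_inv_cancel_left, hg₂_def, mul_inv_cancel_left, mul_inv_cancel_left] at h5

theorem evenInCommutator (hd : Odd d) (h3 : 3 ≤ d) (k : ℕ) : EvenInCommutator d k := by
  induction k with
  | zero =>
    intro g _ _
    rw [levelStab_zero, sup_top_eq]
    trivial
  | succ k ih => exact ih.succ hd h3

/-! ### Recursions for the level indices -/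

theorem comap_diag_levelStab_succ (k : ℕ) :
    (levelStab d (k + 1)).comap diag = Subgroup.pi Set.univ fun _ => levelStab d k := by
  ext f
  rw [Subgroup.mem_comap, diag_mem_levelStab_succ, Subgroup.mem_pi]
  simp

theorem map_diag_comap_diag (H : Subgroup (AutT d)) : (H.comap diag).map diag = levelStab d 1 ⊓ H := by
  ext g
  rw [levelStab_one]
  constructor
  · rintro ⟨f, hf, rfl⟩
    exact ⟨root_diag f, hf⟩
  · rintro ⟨h1, h2⟩
    exact ⟨sec g, by rwa [← diag_sec (MonoidHom.mem_ker.1 h1)] at h2, diag_sec h1⟩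

/-- The index is split at the first-level stabilizer, which is the image of `diag`. -/
theorem relIndex_levelStab_succ (k : ℕ) (H : Subgroup (AutT d)) :
    (levelStab d (k + 1)).relIndex H =
      (Subgroup.pi Set.univ fun _ => levelStab d k).relIndex (H.comap diag) *
        Nat.card (H.map root) := by
  rw [← comap_diag_levelStab_succ, Subgroup.relIndex_comap, map_diag_comap_diag,
    ← Subgroup.relIndex_ker, ← levelStab_one, Subgroup.relIndex_inf_mul_relIndex,
    inf_eq_left.2 (levelStab_antitone d (by omega))]

theorem relIndex_pi_pi {ι : Type*} [Fintype ι] {M : Type*} [Group M] (K H : Subgroup M) :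
    (Subgroup.pi Set.univ fun _ : ι => K).relIndex (Subgroup.pi Set.univ fun _ => H) =
      K.relIndex H ^ Fintype.card ι := by
  have h1 : (Subgroup.pi Set.univ fun _ : ι => H) =
      (⊤ : Subgroup (ι → H)).map (MonoidHom.piMap fun _ => H.subtype) := by
    ext f
    constructor
    · exact fun hf => ⟨fun i => ⟨f i, hf i trivial⟩, trivial, rfl⟩
    · rintro ⟨f, -, rfl⟩ i -
      exact (f i).2
  have h2 : (Subgroup.pi Set.univ fun _ : ι => K).comap (MonoidHom.piMap fun _ => H.subtype) =
      Subgroup.pi Set.univ fun _ : ι => K.subgroupOf H := rfl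
  rw [h1, ← Subgroup.relIndex_comap, h2, Subgroup.relIndex_top_right, Subgroup.index_pi]
  simp [Subgroup.relIndex]

theorem index_levelStab_succ (k : ℕ) :
    (levelStab d (k + 1)).index = (levelStab d k).index ^ d * d.factorial := by
  have h1 : (⊤ : Subgroup (AutT d)).map root = ⊤ :=
    Subgroup.map_top_of_surjective _ root_surjective
  rw [← Subgroup.relIndex_top_right, relIndex_levelStab_succ, h1, Subgroup.comap_top,
    Subgroup.relIndex_top_right, Subgroup.index_pi, Subgroup.card_top, Nat.card_perm]
  simp

theorem relIndex_levelStab_one (hd : Odd d) : (levelStab d 1).relIndex (G d) = d.factorial := by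
  rw [levelStab_one, Subgroup.relIndex_ker, map_root_G hd, Subgroup.card_top, Nat.card_perm]
  simp

/-- The product of the signs of a tuple of automorphisms. -/
def sgnProd (d : ℕ) : (Fin d → AutT d) →* ℤˣ where
  toFun f := ∏ x, sgn (f x)
  map_one' := by simp
  map_mul' f g := by simp [Finset.prod_mul_distrib]

theorem sgnProd_apply (f : Fin d → AutT d) : sgnProd d f = ∏ x, sgn (f x) := rfl

/-- Modulo `P`, the tuples coming from `G` are those with entries in `G` and sign product 1. These
form a subgroup of index 2 among all tuples over `G`. -/
theorem relIndex_levelStab_succ_succ (hd : Odd d) (h3 : 3 ≤ d) (k : ℕ) :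
    (levelStab d (k + 2)).relIndex (G d) * 2 =
      (levelStab d (k + 1)).relIndex (G d) ^ d * d.factorial := by
  set P := Subgroup.pi Set.univ fun _ : Fin d => levelStab d (k + 1) with hP
  set N := (sgnProd d).ker ⊓ Subgroup.pi Set.univ fun _ => G d with hN
  have : P.Normal := by
    rw [hP, ← comap_diag_levelStab_succ]
    infer_instance
  have h1 : (G d).comap diag ⊔ P = N ⊔ P := by
    apply le_antisymm
    · refine sup_le_sup_right (fun f hf => ⟨?_, fun x _ => ?_⟩) _
      · have := prod_sgn_sec (by omega) (Subgroup.mem_comap.1 hf)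
        simp only [sec_diag] at this
        exact MonoidHom.mem_ker.2 this
      · simpa using sec_mem (Subgroup.mem_comap.1 hf) x
    · refine sup_le ?_ le_sup_right
      rintro f ⟨hf, hf'⟩
      obtain ⟨h, hh, hh'⟩ := (evenInCommutator hd h3 (k + 1)).exists_sec_eq hd h3
        (fun x => hf' x trivial) hf
      refine Subgroup.mem_sup_of_normal_right.2 ⟨h, hh, h⁻¹ * f, ?_, mul_inv_cancel_left _ _⟩
      rw [hP, ← comap_diag_levelStab_succ, Subgroup.mem_comap, map_mul, map_inv]
      exact hh'
  -- This needs sections known to level at least 1, so the recursion starts only at level 1.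
  have h2 : P ≤ (sgnProd d).ker := by
    intro f hf
    rw [MonoidHom.mem_ker, sgnProd_apply]
    refine Finset.prod_eq_one fun x _ => ?_
    have h4 : f x ∈ levelStab d 1 := levelStab_antitone d (by omega) (hf x trivial)
    rw [levelStab_one, MonoidHom.mem_ker] at h4
    rw [sgn_apply, h4, map_one]
  have h4 : (Subgroup.pi Set.univ fun _ => G d).map (sgnProd d) = ⊤ := by
    rw [eq_top_iff]
    intro s _
    rcases Int.units_eq_one_or s with rfl | rfl
    · exact one_mem _
    · have i : Fin d := ⟨0, hd.pos⟩
      -- A constant odd tuple has sign product (-1)^d = -1.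
      refine ⟨fun _ => gen i, fun x _ => gen_mem i, ?_⟩
      rw [sgnProd_apply, sgn_gen (by omega)]
      simp [hd.neg_one_pow]
  have h5 := Subgroup.relIndex_inf_mul_relIndex P (sgnProd d).ker
    (Subgroup.pi Set.univ fun _ => G d)
  rw [inf_eq_left.2 h2, ← hN, Subgroup.relIndex_ker, h4, hP, relIndex_pi_pi, ← hP,
    ← Subgroup.relIndex_sup_right, ← h1, Subgroup.relIndex_sup_right, Subgroup.card_top,
    Nat.card_eq_fintype_card, Fintype.card_units_int, Fintype.card_fin] at h5
  rw [relIndex_levelStab_succ, ← h5, map_root_G hd, Subgroup.card_top, Nat.card_perm]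
  simp only [Nat.card_eq_fintype_card, Fintype.card_fin]
  ring

/-! ### Solving the recursion -/

open Filter Topology

/-- The Hausdorff dimension of the closure of `G d`. -/
noncomputable def expectedDim (d : ℕ) : ℝ :=
  1 - Real.log 2 / ((d : ℝ) * Real.log (d.factorial : ℝ))

theorem log_two_le_log_factorial (h2 : 2 ≤ d) : Real.log 2 ≤ Real.log (d.factorial : ℝ) := by
  have h1 : (2 : ℝ) ≤ (d.factorial : ℝ) := by exact_mod_cast h2.trans d.self_le_factorial
  exact Real.log_le_log (by norm_num) h1

theorem log_factorial_pos (h2 : 2 ≤ d) : 0 < Real.log (d.factorial : ℝ) :=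
  (Real.log_pos (by norm_num)).trans_le (log_two_le_log_factorial h2)

theorem expectedDim_pos (h2 : 2 ≤ d) : 0 < expectedDim d := by
  have h1 := log_two_le_log_factorial h2
  have h3 := log_factorial_pos h2
  have h4 : (2 : ℝ) ≤ d := by exact_mod_cast h2
  rw [expectedDim, sub_pos, div_lt_one (by positivity)]
  nlinarith

theorem expectedDim_mul (h2 : 2 ≤ d) : expectedDim d * Real.log (d.factorial : ℝ) =
    Real.log (d.factorial : ℝ) - Real.log 2 / d := by
  have h3 := (log_factorial_pos h2).ne'
  have h4 : (d : ℝ) ≠ 0 := by positivity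
  rw [expectedDim]
  field_simp

theorem index_levelStab_pos (d k : ℕ) : (0 : ℝ) < (levelStab d k).index :=
  Nat.cast_pos.2 (Nat.pos_of_ne_zero Subgroup.FiniteIndex.index_ne_zero)

theorem relIndex_levelStab_pos (k : ℕ) (H : Subgroup (AutT d)) :
    (0 : ℝ) < (levelStab d k).relIndex H :=
  Nat.cast_pos.2 (Nat.pos_of_ne_zero Subgroup.FiniteIndex.index_ne_zero)

theorem log_index_succ (k : ℕ) : Real.log ((levelStab d (k + 1)).index : ℝ) =
    d * Real.log ((levelStab d k).index : ℝ) + Real.log (d.factorial : ℝ) := by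
  have h := index_levelStab_pos d k
  rw [index_levelStab_succ, Nat.cast_mul, Nat.cast_pow,
    Real.log_mul (by positivity) (by positivity), Real.log_pow]

theorem log_index_zero : Real.log ((levelStab d 0).index : ℝ) = 0 := by
  simp [levelStab_zero]

/-- Both logarithms satisfy affine recursions with slope `d`, and (log 2)/d is the offset preserved.
At level 0 both vanish, so the formula holds only from level 1 on. -/
theorem log_relIndex_succ (hd : Odd d) (h3 : 3 ≤ d) (k : ℕ) :
    Real.log ((levelStab d (k + 1)).relIndex (G d) : ℝ) =
      expectedDim d * Real.log ((levelStab d (k + 1)).index : ℝ) + Real.log 2 / d := by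
  have h4 := expectedDim_mul (d := d) (by omega)
  have h0 : (d : ℝ) ≠ 0 := by positivity
  induction k with
  | zero =>
    rw [zero_add, relIndex_levelStab_one hd, log_index_succ 0, log_index_zero, mul_zero, zero_add,
      h4]
    ring
  | succ k ih =>
    have h5 := congrArg (fun n : ℕ => Real.log n) (relIndex_levelStab_succ_succ hd h3 k)
    have h6 := relIndex_levelStab_pos (k + 2) (G d)
    have h7 := relIndex_levelStab_pos (k + 1) (G d)
    simp only [Nat.cast_mul, Nat.cast_pow, Nat.cast_ofNat] at h5
    rw [Real.log_mul (by positivity) (by norm_num), Real.log_mul (by positivity) (by positivity),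
      Real.log_pow, ih] at h5
    rw [log_index_succ (k + 1), mul_add, h4, eq_sub_of_add_eq h5]
    field_simp
    ring

theorem relIndex_succ_eq (hd : Odd d) (h3 : 3 ≤ d) (k : ℕ) :
    ((levelStab d (k + 1)).relIndex (G d) : ℝ) =
      ((levelStab d (k + 1)).index : ℝ) ^ expectedDim d * Real.exp (Real.log 2 / d) := by
  rw [← Real.exp_log (relIndex_levelStab_pos (k + 1) (G d)), log_relIndex_succ hd h3, Real.exp_add,
    Real.rpow_def_of_pos (index_levelStab_pos d _), mul_comm (expectedDim d)]

theorem index_rpow_le_relIndex (hd : Odd d) (h3 : 3 ≤ d) (k : ℕ) :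
    ((levelStab d k).index : ℝ) ^ expectedDim d ≤ (levelStab d k).relIndex (G d) := by
  cases k with
  | zero => simp [levelStab_zero]
  | succ k =>
    rw [relIndex_succ_eq hd h3]
    refine le_mul_of_one_le_right (by positivity) (Real.one_le_exp ?_)
    have := Real.log_pos (x := 2) (by norm_num)
    positivity

theorem tendsto_log_index (h2 : 2 ≤ d) :
    Tendsto (fun k => Real.log ((levelStab d k).index : ℝ)) atTop atTop := by
  have h1 : ∀ k : ℕ, k * Real.log (d.factorial : ℝ) ≤ Real.log ((levelStab d k).index : ℝ) := by
    intro k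
    induction k with
    | zero => simp [log_index_zero]
    | succ k ih =>
      have h4 := Real.log_natCast_nonneg (levelStab d k).index
      have h5 : (1 : ℝ) ≤ d := by exact_mod_cast (by omega : 1 ≤ d)
      rw [log_index_succ]
      push_cast
      nlinarith
  exact tendsto_atTop_mono h1
    (tendsto_natCast_atTop_atTop.atTop_mul_const (log_factorial_pos h2))

theorem tendsto_index_inv (h2 : 2 ≤ d) :
    Tendsto (fun k => ((levelStab d k).index : ℝ)⁻¹) atTop (𝓝 0) := by
  refine tendsto_inv_atTop_zero.comp (tendsto_atTop_mono (fun k => ?_) (tendsto_log_index h2))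
  exact (Real.log_le_sub_one_of_pos (index_levelStab_pos d k)).trans (by linarith)

theorem levelDimension_G (hd : Odd d) (h3 : 3 ≤ d) : levelDimension (G d) = expectedDim d := by
  refine Tendsto.liminf_eq ?_
  rw [← tendsto_add_atTop_iff_nat 1]
  have h1 := tendsto_log_index (d := d) (by omega)
  have h2 : Tendsto (fun k => expectedDim d +
      Real.log 2 / d / Real.log ((levelStab d (k + 1)).index : ℝ)) atTop (𝓝 (expectedDim d + 0)) :=
    tendsto_const_nhds.add (((tendsto_add_atTop_iff_nat 1).2 h1).const_div_atTop _)
  rw [add_zero] at h2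
  refine h2.congr' ?_
  filter_upwards [((tendsto_add_atTop_iff_nat 1).2 h1).eventually_gt_atTop 0] with k hk
  rw [log_relIndex_succ hd h3, add_div, mul_div_cancel_right₀ _ hk.ne']

/-- Squeezed between 1 - 1/d and 1, since log 2 ≤ log d!. -/
theorem tendsto_expectedDim : Tendsto expectedDim atTop (𝓝 1) := by
  have h1 : Tendsto (fun d : ℕ => 1 - (1 : ℝ) / d) atTop (𝓝 (1 - 0)) :=
    tendsto_const_nhds.sub tendsto_one_div_atTop_nhds_zero_nat
  rw [sub_zero] at h1
  refine tendsto_of_tendsto_of_tendsto_of_le_of_le' h1 tendsto_const_nhds ?_ ?_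
  · filter_upwards [eventually_ge_atTop 2] with d hd
    have h3 := log_factorial_pos hd
    have h4 : (0 : ℝ) < d := by exact_mod_cast (by omega : 0 < d)
    rw [expectedDim, div_mul_eq_div_div_swap]
    gcongr
    exact (div_le_one h3).2 (log_two_le_log_factorial hd)
  · filter_upwards [eventually_ge_atTop 2] with d hd
    have h3 := log_factorial_pos hd
    have := Real.log_pos (x := 2) (by norm_num)
    exact sub_le_self _ (by positivity)

/-! ### Metric and topology of the automorphism group -/

theorem dist_eq_distance (g h : AutT d) : dist g h = distance g h := rfl

theorem dist_le_of_mem {k : ℕ} {g h : AutT d} (H : g⁻¹ * h ∈ levelStab d k) :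
    dist g h ≤ ((levelStab d k).index : ℝ)⁻¹ := by
  rw [dist_eq_distance, distance]
  split_ifs
  · exact (index_inv_pos d k).le
  · exact csInf_le (radii_bddBelow g h) ⟨k, H, rfl⟩

theorem le_dist_of_notMem_succ {k : ℕ} {g h : AutT d} (H : g⁻¹ * h ∉ levelStab d (k + 1)) :
    ((levelStab d k).index : ℝ)⁻¹ ≤ dist g h := by
  have hne : g ≠ h := by
    rintro rfl
    rw [inv_mul_cancel] at H
    exact H (one_mem _)
  rw [dist_eq_distance, distance, if_neg hne]
  refine le_csInf (radii_nonempty g h) ?_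
  rintro _ ⟨l, hl, rfl⟩
  refine index_inv_antitone d (not_lt.1 fun hlt => H ?_)
  exact levelStab_antitone d hlt hl

theorem mem_of_dist_lt {k : ℕ} {g h : AutT d} (H : dist g h < ((levelStab d k).index : ℝ)⁻¹) :
    g⁻¹ * h ∈ levelStab d k := by
  cases k with
  | zero =>
    rw [levelStab_zero]
    trivial
  | succ k =>
    by_contra hn
    exact H.not_ge ((index_inv_antitone d k.le_succ).trans (le_dist_of_notMem_succ hn))

theorem dist_congr {g h g' h' : AutT d}
    (H : ∀ k, g⁻¹ * h ∈ levelStab d k ↔ g'⁻¹ * h' ∈ levelStab d k) (h0 : g = h ↔ g' = h') :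
    dist g h = dist g' h' := by
  have : radii g h = radii g' h' := by
    ext r
    exact exists_congr fun k => and_congr_left fun _ => H k
  rw [dist_eq_distance, dist_eq_distance, distance, distance, this]
  by_cases h : g = h
  · rw [if_pos h, if_pos (h0.1 h)]
  · rw [if_neg h, if_neg (mt h0.2 h)]

theorem dist_mul_left' (f g h : AutT d) : dist (f * g) (f * h) = dist g h :=
  dist_congr (fun k => by rw [mul_inv_rev, mul_assoc, inv_mul_cancel_left]) (mul_right_inj f)

/-- Right invariance comes from normality of the level stabilizers. -/
theorem dist_mul_right' (f g h : AutT d) : dist (g * f) (h * f) = dist g h :=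
  dist_congr (fun k => by
    have : (g * f)⁻¹ * (h * f) = f⁻¹ * (g⁻¹ * h) * f⁻¹⁻¹ := by group
    rw [this]
    exact ((levelStab_normal k).mem_comm_iff.trans (by simp))) (mul_left_inj f)

instance : IsTopologicalGroup (AutT d) where
  continuous_mul := by
    rw [Metric.continuous_iff]
    rintro ⟨g, h⟩ ε hε
    refine ⟨ε / 2, by positivity, ?_⟩
    rintro ⟨g', h'⟩ H
    rw [Prod.dist_eq, max_lt_iff] at H
    calc dist (g' * h') (g * h) ≤ dist (g' * h') (g' * h) + dist (g' * h) (g * h) :=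
          dist_triangle _ _ _
      _ < ε := by
          rw [dist_mul_left', dist_mul_right']
          linarith [H.1, H.2]
  continuous_inv := by
    rw [Metric.continuous_iff]
    intro g ε hε
    refine ⟨ε, hε, fun h H => ?_⟩
    have : dist h⁻¹ g⁻¹ = dist g h := by
      rw [← dist_mul_left' g, ← dist_mul_right' h]
      simp
    rwa [this, dist_comm]

theorem isOpen_levelStab (k : ℕ) : IsOpen (levelStab d k : Set (AutT d)) := by
  refine Subgroup.isOpen_of_mem_nhds _ (g := 1)
    (Metric.mem_nhds_iff.2 ⟨_, index_inv_pos d k, fun g hg => ?_⟩)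
  rw [Metric.mem_ball, dist_comm] at hg
  simpa using mem_of_dist_lt hg

theorem completeSpace_AutT (h2 : 2 ≤ d) : CompleteSpace (AutT d) := by
  refine Metric.complete_of_convergent_controlled_sequences _ (index_inv_pos d) fun u hu => ?_
  have hu' : ∀ N n m, N ≤ n → N ≤ m → (u n)⁻¹ * u m ∈ levelStab d N :=
    fun N n m hn hm => mem_of_dist_lt (hu N n m hn hm)
  have h1 : ∀ (w : List (Fin d)) n, w.length ≤ n → (u n).1 w = (u w.length).1 w := fun w n hn =>
    inv_mul_mem_levelStab.1 (hu' w.length n w.length hn le_rfl) w rfl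
  have h3 : ∀ (w : List (Fin d)) n, w.length ≤ n → (u n)⁻¹.1 w = (u w.length)⁻¹.1 w := by
    intro w n hn
    have h4 := (levelStab_normal w.length).conj_mem _ (hu' w.length w.length n le_rfl hn)
      (u w.length)
    rw [mul_inv_cancel_left] at h4
    exact inv_mul_mem_levelStab.1 (by rwa [inv_inv]) w rfl
  -- The terms from index `w.length` on agree at `w`, so that term defines the limit there; `h3`
  -- gives the same for the inverses.
  let g : AutT d := ofEquiv
    { toFun := fun w => (u w.length).1 w
      invFun := fun w => (u w.length)⁻¹.1 w
      left_inv := fun w => by simp only [length_map, inv_apply_self]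
      right_inv := fun w => by simp only [length_map, apply_inv_self] }
    (apply_nil _)
    (fun w x => by
      obtain ⟨y, hy⟩ := map_append_singleton (u (w ++ [x]).length) w x
      exact ⟨y, hy.trans (by rw [h1 w _ (by simp)]; rfl)⟩)
    (fun w x => by
      obtain ⟨y, hy⟩ := map_append_singleton (u (w ++ [x]).length)⁻¹ w x
      exact ⟨y, hy.trans (by rw [h3 w _ (by simp)]; rfl)⟩)
  refine ⟨g, ?_⟩
  rw [tendsto_iff_dist_tendsto_zero]
  refine squeeze_zero (fun _ => dist_nonneg) (fun n => dist_le_of_mem (k := n) ?_)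
    (tendsto_index_inv h2)
  rw [inv_mul_mem_levelStab]
  rintro w rfl
  rfl

theorem compactSpace_AutT (h2 : 2 ≤ d) : CompactSpace (AutT d) := by
  have := completeSpace_AutT h2
  refine ⟨isCompact_iff_totallyBounded_isComplete.2 ⟨?_, isComplete_univ⟩⟩
  rw [Metric.totallyBounded_iff]
  intro ε hε
  obtain ⟨k, hk⟩ := ((tendsto_index_inv h2).eventually_lt_const hε).exists
  refine ⟨Set.range fun q : AutT d ⧸ levelStab d k => q.out, Set.finite_range _, fun g _ => ?_⟩
  simp only [Set.mem_range, Set.iUnion_exists, Set.iUnion_iUnion_eq', Set.mem_iUnion]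
  refine ⟨(g : AutT d ⧸ levelStab d k), Metric.mem_ball.2 (lt_of_le_of_lt (dist_le_of_mem ?_) hk)⟩
  rw [← QuotientGroup.eq]
  exact (QuotientGroup.out_eq' _).symm

/-! ### Hausdorff dimension of the closure -/

open MeasureTheory

theorem ediam_le_of_forall_mem {k : ℕ} {s : Set (AutT d)}
    (h : ∀ g ∈ s, ∀ g' ∈ s, g⁻¹ * g' ∈ levelStab d k) :
    Metric.ediam s ≤ ENNReal.ofReal ((levelStab d k).index : ℝ)⁻¹ :=
  Metric.ediam_le fun g hg g' hg' => by
    rw [edist_dist]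
    exact ENNReal.ofReal_le_ofReal (dist_le_of_mem (h g hg g' hg'))

/-- The covers by cosets of level stabilizers have D-sums at most exp((log 2)/d) at every level, so
the D-dimensional Hausdorff measure is finite. -/
theorem dimH_closure_le (hd : Odd d) (h3 : 3 ≤ d) :
    dimH (closure (G d : Set (AutT d))) ≤ ENNReal.ofReal (expectedDim d) := by
  let _ : MeasurableSpace (AutT d) := borel _
  have _ : BorelSpace (AutT d) := ⟨rfl⟩
  refine dimH_le_of_hausdorffMeasure_ne_top (d := (expectedDim d).toNNReal) ?_
  rw [Real.coe_toNNReal _ (expectedDim_pos (by omega)).le]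
  let ι : ℕ → Type := fun k => G d ⧸ (levelStab d (k + 1)).subgroupOf (G d)
  have : ∀ k, Fintype (ι k) := fun k => Fintype.ofFinite _
  let t : ∀ k, ι k → Set (AutT d) := fun k q =>
    {g | (q.out : AutT d)⁻¹ * g ∈ levelStab d (k + 1)}
  have ht : ∀ k q, Metric.ediam (t k q) ≤
      ENNReal.ofReal ((levelStab d (k + 1)).index : ℝ)⁻¹ := by
    refine fun k q => ediam_le_of_forall_mem fun g hg g' hg' => ?_
    have hg₁ : (q.out : AutT d)⁻¹ * g ∈ levelStab d (k + 1) := hg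
    have hg₂ : (q.out : AutT d)⁻¹ * g' ∈ levelStab d (k + 1) := hg'
    have := mul_mem (inv_mem hg₁) hg₂
    rwa [mul_inv_rev, inv_inv, mul_assoc, mul_inv_cancel_left] at this
  have h1 := Measure.hausdorffMeasure_le_liminf_sum (expectedDim d)
    (closure (G d : Set (AutT d))) (l := atTop)
    (fun k : ℕ => ENNReal.ofReal ((levelStab d (k + 1)).index : ℝ)⁻¹)
    (by
      rw [← ENNReal.ofReal_zero]
      exact ENNReal.tendsto_ofReal
        ((tendsto_add_atTop_iff_nat 1).2 (tendsto_index_inv (d := d) (by omega)))) t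
    (Eventually.of_forall ht)
    (Eventually.of_forall fun k g hg => by
      -- A point of `G` this close to `g` lies in the same coset, so representatives from `G`
      -- suffice.
      obtain ⟨h, hh, hgh⟩ := Metric.mem_closure_iff.1 hg _ (index_inv_pos d (k + 1))
      have h4 := inv_mem (mem_of_dist_lt hgh)
      rw [mul_inv_rev, inv_inv] at h4
      let q : ι k := ((⟨h, hh⟩ : G d) : G d ⧸ (levelStab d (k + 1)).subgroupOf (G d))
      have h5 : (q.out)⁻¹ * (⟨h, hh⟩ : G d) ∈ (levelStab d (k + 1)).subgroupOf (G d) := by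
        rw [← QuotientGroup.eq]
        exact QuotientGroup.out_eq' _
      refine Set.mem_iUnion.2 ⟨q, ?_⟩
      have h6 := mul_mem (Subgroup.mem_subgroupOf.1 h5) h4
      change (q.out : AutT d)⁻¹ * g ∈ levelStab d (k + 1)
      simpa [mul_assoc] using h6)
  have h2 : ∀ k, ∑ q, Metric.ediam (t k q) ^ expectedDim d ≤
      ENNReal.ofReal (Real.exp (Real.log 2 / d)) := by
    intro k
    have hn := index_levelStab_pos d (k + 1)
    calc ∑ q, Metric.ediam (t k q) ^ expectedDim d
        ≤ ∑ q : ι k, ENNReal.ofReal ((levelStab d (k + 1)).index : ℝ)⁻¹ ^ expectedDim d :=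
          Finset.sum_le_sum fun q _ =>
            ENNReal.rpow_le_rpow (ht k q) (expectedDim_pos (by omega)).le
      _ = ENNReal.ofReal ((levelStab d (k + 1)).relIndex (G d) *
            ((levelStab d (k + 1)).index : ℝ)⁻¹ ^ expectedDim d) := by
          rw [Finset.sum_const, Finset.card_univ, nsmul_eq_mul,
            ENNReal.ofReal_rpow_of_pos (inv_pos.2 hn), ENNReal.ofReal_mul (by positivity),
            ENNReal.ofReal_natCast, ← Nat.card_eq_fintype_card]
          rfl
      _ = _ := by
          have := Real.rpow_pos_of_pos hn (expectedDim d)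
          rw [relIndex_succ_eq hd h3, Real.inv_rpow hn.le]
          congr 1
          field_simp
  refine ne_top_of_le_ne_top (ENNReal.ofReal_ne_top (r := Real.exp (Real.log 2 / d)))
    (h1.trans ?_)
  exact (liminf_le_liminf (Eventually.of_forall h2)).trans (liminf_const _).le

/-- The closure of `G d` carries a probability measure whose value on every coset of the `k`-th
level stabilizer is at most the inverse of the index of that stabilizer in `G d`. -/
theorem exists_measure_closure [MeasurableSpace (AutT d)] [BorelSpace (AutT d)] (h2 : 2 ≤ d) :
    ∃ ν : Measure (AutT d), ν (closure (G d : Set (AutT d))) = 1 ∧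
      ∀ k (g : AutT d), ν {h | g⁻¹ * h ∈ levelStab d k} ≤
        ((levelStab d k).relIndex (G d) : ENNReal)⁻¹ := by
  have := compactSpace_AutT h2
  let K := (G d).topologicalClosure
  have hKc : IsClosed (K : Set (AutT d)) := (G d).isClosed_topologicalClosure
  have : CompactSpace K := isCompact_iff_compactSpace.1 hKc.isCompact
  let μ : Measure K := Measure.haarMeasure ⊤
  have hμ : μ Set.univ = 1 := by
    have := Measure.haarMeasure_self (K₀ := (⊤ : TopologicalSpace.PositiveCompacts K))
    rwa [TopologicalSpace.PositiveCompacts.coe_top] at this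
  have hval : Measurable (Subtype.val : K → AutT d) := measurable_subtype_coe
  have hK : ∀ k, μ ((levelStab d k).subgroupOf K) ≤
      ((levelStab d k).relIndex (G d) : ENNReal)⁻¹ := by
    intro k
    have hm : MeasurableSet ((levelStab d k).subgroupOf K : Set K) :=
      ((isOpen_levelStab k).preimage continuous_subtype_val).measurableSet
    have h1 := ((levelStab d k).subgroupOf K).index_mul_measure hm μ
    rw [hμ] at h1
    rw [← one_div, ENNReal.le_div_iff_mul_le (Or.inl (by
      exact_mod_cast (Nat.cast_pos.1 (relIndex_levelStab_pos (d := d) k (G d))).ne'))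
      (Or.inl (ENNReal.natCast_ne_top _)), ← h1, mul_comm]
    gcongr
    -- The measure is the inverse of the index in the closure, which is at least the index in `G`.
    exact Subgroup.relIndex_le_of_le_right (G d).le_topologicalClosure
      Subgroup.FiniteIndex.index_ne_zero
  refine ⟨μ.map Subtype.val, ?_, fun k g => ?_⟩
  · rw [Measure.map_apply hval isClosed_closure.measurableSet]
    convert hμ
    ext x
    exact iff_of_true x.2 trivial
  · have hmeas : MeasurableSet {h : AutT d | g⁻¹ * h ∈ levelStab d k} :=
      ((isOpen_levelStab k).preimage (continuous_const_mul g⁻¹)).measurableSet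
    rw [Measure.map_apply hval hmeas]
    -- The coset either misses the closure or meets it inside a translate of the stabilizer by one
    -- of its points; left invariance then applies.
    rcases Set.eq_empty_or_nonempty
      ((Subtype.val : K → AutT d) ⁻¹' {h | g⁻¹ * h ∈ levelStab d k}) with h1 | ⟨b, hb⟩
    · rw [h1, measure_empty]
      exact zero_le
    · have h1 : (Subtype.val : K → AutT d) ⁻¹' {h | g⁻¹ * h ∈ levelStab d k} ⊆
          (fun x => b⁻¹ * x) ⁻¹' ((levelStab d k).subgroupOf K : Set K) := by
        intro x hx
        have hb' : g⁻¹ * b.1 ∈ levelStab d k := hb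
        have hx' : g⁻¹ * x.1 ∈ levelStab d k := hx
        have h5 := mul_mem (inv_mem hb') hx'
        rw [mul_inv_rev, inv_inv, mul_assoc, mul_inv_cancel_left] at h5
        exact Subgroup.mem_subgroupOf.2 h5
      refine (measure_mono h1).trans ?_
      rw [measure_preimage_mul]
      exact hK k

/-- Mass distribution: let `k` be the deepest level on which all points of `s` agree. Then `s` lies
in one coset, of mass at most n_k^(-D), while two points differ on level `k + 1`, so the diameter is
at least 1/n_k. -/
theorem le_dimH_closure (hd : Odd d) (h3 : 3 ≤ d) :
    ENNReal.ofReal (expectedDim d) ≤ dimH (closure (G d : Set (AutT d))) := by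
  let _ : MeasurableSpace (AutT d) := borel _
  have _ : BorelSpace (AutT d) := ⟨rfl⟩
  have h2 : 2 ≤ d := by omega
  have hpos := expectedDim_pos h2
  obtain ⟨ν, hν, hν'⟩ := exists_measure_closure h2
  have hν'' : ∀ k (g : AutT d), ν {h | g⁻¹ * h ∈ levelStab d k} ≤
      ENNReal.ofReal ((levelStab d k).index : ℝ)⁻¹ ^ expectedDim d := by
    intro k g
    have hn := index_levelStab_pos d k
    refine (hν' k g).trans ?_
    rw [ENNReal.ofReal_inv_of_pos hn, ENNReal.inv_rpow, ENNReal.inv_le_inv,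
      ENNReal.ofReal_rpow_of_pos hn, ← ENNReal.ofReal_natCast]
    exact ENNReal.ofReal_le_ofReal (index_rpow_le_relIndex hd h3 k)
  have key : ν ≤ Measure.hausdorffMeasure (expectedDim d) := by
    refine Measure.le_hausdorffMeasure _ _ 1 one_pos fun s _ => ?_
    rcases s.eq_empty_or_nonempty with rfl | ⟨g, hg⟩
    · simp
    -- If no deepest level exists, `s` lies in cosets of arbitrarily small mass and is null.
    by_cases H : ∀ k, ∀ h ∈ s, g⁻¹ * h ∈ levelStab d k
    · have h4 : ν s ≤ 0 := by
        have h5 : Tendsto (fun k => ENNReal.ofReal ((levelStab d k).index : ℝ)⁻¹ ^ expectedDim d)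
            atTop (𝓝 0) := by
          have h6 := ((ENNReal.continuous_rpow_const (y := expectedDim d)).tendsto _).comp
            (ENNReal.tendsto_ofReal (tendsto_index_inv h2))
          rwa [ENNReal.ofReal_zero, ENNReal.zero_rpow_of_pos hpos] at h6
        exact ge_of_tendsto' h5 fun k => (measure_mono (H k)).trans (hν'' k g)
      exact h4.trans zero_le
    · have hex : ∃ k, ¬ ∀ h ∈ s, g⁻¹ * h ∈ levelStab d k := not_forall.1 H
      classical
      obtain ⟨k, hk⟩ : ∃ k, Nat.find hex = k + 1 := by
        refine Nat.exists_eq_succ_of_ne_zero fun h0 => ?_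
        have := Nat.find_spec hex
        rw [h0, levelStab_zero] at this
        exact this fun _ _ => trivial
      have h4 : ∀ h ∈ s, g⁻¹ * h ∈ levelStab d k := not_not.1 (Nat.find_min hex (by omega))
      have h5 := Nat.find_spec hex
      rw [hk] at h5
      push Not at h5
      obtain ⟨h, hh, h5⟩ := h5
      refine (measure_mono h4).trans ((hν'' k g).trans (ENNReal.rpow_le_rpow ?_ hpos.le))
      refine le_trans ?_ (Metric.edist_le_ediam_of_mem hg hh)
      rw [edist_dist]
      exact ENNReal.ofReal_le_ofReal (le_dist_of_notMem_succ h5)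
  refine le_dimH_of_hausdorffMeasure_ne_zero (d := (expectedDim d).toNNReal) ?_
  rw [Real.coe_toNNReal _ hpos.le]
  intro h0
  have := key (closure (G d : Set (AutT d)))
  rw [h0, hν] at this
  exact one_ne_zero (le_antisymm this zero_le)

theorem dimH_closure_G (hd : Odd d) (h3 : 3 ≤ d) :
    dimH (closure (G d : Set (AutT d))) = ENNReal.ofReal (expectedDim d) :=
  le_antisymm (dimH_closure_le hd h3) (le_dimH_closure hd h3)

end RootedTree

theorem mainTheorem11 :
    (∀ d : ℕ, Odd d → 3 ≤ d →
      dimH (closure (RootedTree.G d : Set (RootedTree.AutT d)))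
          = ENNReal.ofReal (1 - Real.log 2 / ((d : ℝ) * Real.log (d.factorial : ℝ))) ∧
      RootedTree.levelDimension (RootedTree.G d)
          = 1 - Real.log 2 / ((d : ℝ) * Real.log (d.factorial : ℝ))) ∧
    Filter.Tendsto (fun d : ℕ => dimH (closure (RootedTree.G d : Set (RootedTree.AutT d))))
      (Filter.atTop ⊓ Filter.principal {d : ℕ | Odd d}) (nhds 1) := by
  refine ⟨fun d hd h3 => ⟨RootedTree.dimH_closure_G hd h3, RootedTree.levelDimension_G hd h3⟩, ?_⟩
  have h1 := (ENNReal.tendsto_ofReal RootedTree.tendsto_expectedDim).mono_left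
    (inf_le_left (b := Filter.principal {d : ℕ | Odd d}))
  rw [ENNReal.ofReal_one] at h1
  refine h1.congr' ?_
  -- The formula is available only from `d = 3` on, which suffices for the limit.
  filter_upwards [Filter.mem_inf_of_right (Filter.mem_principal_self _),
    Filter.mem_inf_of_left (Filter.eventually_ge_atTop 3)] with d hd h3
  exact (RootedTree.dimH_closure_G hd h3).symm
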